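/- Let $n\ge 0$ be an integer and let $f_n$ be a real analytic function on $[0,1]$ that satisfies $$f''+\frac{2}{\rho}f'-\frac{\sin(2f)}{\rho^2(1-\rho^2)}=0\quad\text{on }(0,1),\qquad f(0)=0,\quad f(1)=\frac{\pi}{2},$$ and takes the value $\frac{\pi}{2}$ at exactly $n$ points of $[0,1)$. On $(0,1)$ put $$w(\rho)=\frac{\rho^2}{(1-\rho^2)^2},\qquad p(\rho)=\rho^2,\qquad q_n(\rho)=\frac{2(1-\rho^2)\cos(2f_n(\rho))-\rho^2}{(1-\rho^2)^2},\qquad a_nu=\frac1w\bigl(-(pu')'+q_nu\bigr),$$ and let $H=L^2_w(0,1)$ be the complex Hilbert space with inner product $(u|v)_H=\int_0^1u\overline{v}\,w\,d\rho$. Let $A_n$ be the maximal operator: $\mathcal D(A_n)=\{u\in H:\ u,pu'\in AC_{\mathrm{loc}}(0,1),\ a_nu\in H\}$ and $A_nu=a_nu$. Then: 1. The endpoints $\rho=0$ and $\rho=1$ are regular singular points of the equation $a_nu=0$; its Frobenius indices are $-2$ and $1$ at $\rho=0$, and $\frac12$ (twice) at $\rho=1$. 2. Both endpoints are in the limit-point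 case: for each of the two endpoints and every $\lambda\in\mathbb C$, the equation $a_nu=\lambda u$ has a solution on $(0,1)$ that is not square integrable with respect to $w\,d\rho$ near that endpoint. 3. The operator $A_n:\mathcal D(A_n)\subset H\to H$ is self-adjoint. -/

import Mathlib

open MeasureTheory Set Filter
open scoped Topology ENNReal

namespace WaveMap

/-- `f` is a self-similar profile with index `n`: an analytic solution on `[0,1]` of
`f'' + (2/ρ) f' - sin(2f) / (ρ²(1-ρ²)) = 0` with `f(0) = 0`, `f(1) = π/2`, whose graph meets the
line `π/2` exactly `n` times on `[0,1)`. Only the values of `f` on `[0,1]` matter. -/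
structure IsProfile (n : ℕ) (f : ℝ → ℝ) : Prop where
  analytic : AnalyticOn ℝ f (Icc 0 1)
  equation : ∀ ρ ∈ Ioo (0 : ℝ) 1,
    deriv (deriv f) ρ + 2 / ρ * deriv f ρ - Real.sin (2 * f ρ) / (ρ ^ 2 * (1 - ρ ^ 2)) = 0
  at_zero : f 0 = 0
  at_one : f 1 = Real.pi / 2
  intersections : {ρ ∈ Ico (0 : ℝ) 1 | f ρ = Real.pi / 2}.encard = n

/-- The weight `w(ρ) = ρ² / (1-ρ²)²`. -/
noncomputable def weight (ρ : ℝ) : ℝ := ρ ^ 2 / (1 - ρ ^ 2) ^ 2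

/-- The leading coefficient `p(ρ) = ρ²`. -/
def leadCoeff (ρ : ℝ) : ℝ := ρ ^ 2

/-- The potential `q(ρ) = (2(1-ρ²)cos(2f(ρ)) - ρ²) / (1-ρ²)²` belonging to the profile `f`. -/
noncomputable def potential (f : ℝ → ℝ) (ρ : ℝ) : ℝ :=
  (2 * (1 - ρ ^ 2) * Real.cos (2 * f ρ) - ρ ^ 2) / (1 - ρ ^ 2) ^ 2

/-- The measure `w(ρ) dρ` on `(0,1)`. -/
noncomputable def weightMeasure : Measure ℝ :=
  (volume.restrict (Ioo (0 : ℝ) 1)).withDensity fun ρ => ENNReal.ofReal (weight ρ)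

/-- The Hilbert space `H = L²_w(0,1)` of complex functions. -/
abbrev WeightedL2 : Type := Lp ℂ 2 weightMeasure

/-- `g ∈ AC_loc(0,1)`: absolute continuity on every compact subinterval of `(0,1)`. -/
def IsACLoc (g : ℝ → ℂ) : Prop :=
  ∀ a b : ℝ, 0 < a → a ≤ b → b < 1 → AbsolutelyContinuousOnInterval g a b

/-- The quasi-derivative `p u'`. -/
noncomputable def quasiDeriv (u : ℝ → ℂ) (ρ : ℝ) : ℂ := (leadCoeff ρ : ℂ) * deriv u ρ

/-- The Sturm–Liouville expression `a u = w⁻¹ (-(p u')' + q u)`. -/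
noncomputable def slExpr (f : ℝ → ℝ) (u : ℝ → ℂ) (ρ : ℝ) : ℂ :=
  (weight ρ : ℂ)⁻¹ * (-deriv (quasiDeriv u) ρ + (potential f ρ : ℂ) * u ρ)

/-- `g` witnesses that the class `u` lies in the maximal domain: `g` represents `u`,
`g, p g' ∈ AC_loc(0,1)` and `a g ∈ L²_w(0,1)`. -/
structure IsDomainRep (f : ℝ → ℝ) (u : WeightedL2) (g : ℝ → ℂ) : Prop where
  ae_eq : u =ᵐ[weightMeasure] g
  ac : IsACLoc g
  ac_quasiDeriv : IsACLoc (quasiDeriv g)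
  memLp : MemLp (slExpr f g) 2 weightMeasure

/-! ### The maximal operator is well defined and linear -/

lemma weight_pos {ρ : ℝ} (h : ρ ∈ Ioo (0 : ℝ) 1) : 0 < weight ρ := by
  have h1 : 0 < 1 - ρ ^ 2 := by nlinarith [h.1, h.2]
  have := h.1
  unfold weight
  positivity

lemma measurable_weight : Measurable weight := by
  unfold weight
  fun_prop

/-- The weighted measure and Lebesgue measure on `(0,1)` have the same null sets. -/
lemma ae_weightMeasure_iff {P : ℝ → Prop} :
    (∀ᵐ ρ ∂weightMeasure, P ρ) ↔ ∀ᵐ ρ, ρ ∈ Ioo (0 : ℝ) 1 → P ρ := by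
  unfold weightMeasure
  rw [ae_withDensity_iff (measurable_weight.ennreal_ofReal),
    ae_restrict_iff' measurableSet_Ioo]
  refine eventually_congr (Eventually.of_forall fun ρ => ?_)
  refine forall_congr' fun h => ?_
  simp [weight_pos h]

lemma IsACLoc.ae_differentiableAt {g : ℝ → ℂ} (hg : IsACLoc g) :
    ∀ᵐ ρ, ρ ∈ Ioo (0 : ℝ) 1 → DifferentiableAt ℝ g ρ := by
  have key : ∀ k : ℕ, ∀ᵐ ρ, ρ ∈ uIcc (1 / ((k : ℝ) + 2)) (1 - 1 / ((k : ℝ) + 2)) →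
      DifferentiableAt ℝ g ρ := by
    intro k
    have h2 : (1 : ℝ) / ((k : ℝ) + 2) ≤ 1 / 2 :=
      one_div_le_one_div_of_le (by norm_num) (by linarith [Nat.cast_nonneg (α := ℝ) k])
    have h0 : (0 : ℝ) < 1 / ((k : ℝ) + 2) := by positivity
    exact (hg _ _ h0 (by linarith) (by linarith)).boundedVariationOn.ae_differentiableAt_of_mem_uIcc
  filter_upwards [ae_all_iff.2 key] with ρ h hρ
  obtain ⟨k, hk⟩ := exists_nat_one_div_lt (lt_min hρ.1 (sub_pos.2 hρ.2))
  have hk' : (1 : ℝ) / ((k : ℝ) + 2) ≤ 1 / ((k : ℝ) + 1) :=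
    one_div_le_one_div_of_le (by positivity) (by linarith)
  refine h k ((Icc_subset_uIcc) ⟨?_, ?_⟩)
  · linarith [min_le_left ρ (1 - ρ)]
  · linarith [min_le_right ρ (1 - ρ)]

lemma IsACLoc.continuousOn {g : ℝ → ℂ} (hg : IsACLoc g) : ContinuousOn g (Ioo 0 1) := by
  intro x hx
  have h := (hg (x / 2) ((x + 1) / 2) (by linarith [hx.1]) (by linarith [hx.1, hx.2])
    (by linarith [hx.2])).continuousOn
  refine (h.continuousAt ?_).continuousWithinAt
  rw [uIcc_of_le (by linarith [hx.1, hx.2])]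
  exact Icc_mem_nhds (by linarith [hx.1]) (by linarith [hx.2])

/-- If `g` and `p g'` are locally absolutely continuous on `(0,1)`, then `g` is differentiable
at every point of `(0,1)`. -/
lemma differentiableAt_of_isACLoc {g : ℝ → ℂ} (hg : IsACLoc g) (hq : IsACLoc (quasiDeriv g))
    {x : ℝ} (hx : x ∈ Ioo (0 : ℝ) 1) : DifferentiableAt ℝ g x := by
  have hcont : ContinuousOn (deriv g) (Ioo 0 1) := by
    have h1 : ContinuousOn (fun ρ : ℝ => ((leadCoeff ρ : ℝ) : ℂ)⁻¹ * quasiDeriv g ρ) (Ioo 0 1) := by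
      refine ContinuousOn.mul (ContinuousOn.inv₀ ?_ ?_) hq.continuousOn
      · unfold leadCoeff
        fun_prop
      · intro ρ hρ
        have := hρ.1.ne'
        simp [leadCoeff, this]
    refine h1.congr fun ρ hρ => ?_
    have := hρ.1.ne'
    simp [quasiDeriv, leadCoeff, this]
  set a := x / 2 with ha
  set b := (x + 1) / 2 with hb
  have hax : a < x := by linarith [hx.1]
  have hxb : x < b := by linarith [hx.2]
  have ha0 : 0 < a := by linarith [hx.1]
  have hb1 : b < 1 := by linarith [hx.2]
  have hab : a ≤ b := by linarith
  have hsub : uIcc a b ⊆ Ioo (0 : ℝ) 1 := by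
    rw [uIcc_of_le hab]
    exact fun y hy => ⟨by linarith [hy.1], by linarith [hy.2]⟩
  have hderiv : ∀ y ∈ Ioo (0 : ℝ) 1, HasDerivAt (fun t => ∫ s in a..t, deriv g s) (deriv g y) y := by
    intro y hy
    have hs : uIcc a y ⊆ Ioo (0 : ℝ) 1 :=
      ordConnected_Ioo.uIcc_subset (hsub left_mem_uIcc) hy
    exact intervalIntegral.integral_hasDerivAt_right ((hcont.mono hs).intervalIntegrable)
      (hcont.stronglyMeasurableAtFilter isOpen_Ioo y hy)
      (hcont.continuousAt (isOpen_Ioo.mem_nhds hy))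
  have hC1 : ContDiffOn ℝ 1 (fun t => ∫ s in a..t, deriv g s) (Ioo 0 1) := by
    rw [contDiffOn_one_iff_derivWithin isOpen_Ioo.uniqueDiffOn]
    refine ⟨fun y hy => (hderiv y hy).differentiableAt.differentiableWithinAt, ?_⟩
    refine hcont.congr fun y hy => ?_
    rw [derivWithin_of_isOpen isOpen_Ioo hy, (hderiv y hy).deriv]
  have hAC := (hg a b ha0 hab hb1).sub (hC1.mono hsub).absolutelyContinuousOnInterval
  obtain ⟨C, hC⟩ := hAC.const_of_ae_hasDerivAt_zero (by
    filter_upwards [hg.ae_differentiableAt] with y hy hyab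
    have := (hy (hsub hyab)).hasDerivAt.sub (hderiv y (hsub hyab))
    simpa using this)
  have hEq : g =ᶠ[𝓝 x] fun t => C + ∫ s in a..t, deriv g s := by
    filter_upwards [Icc_mem_nhds hax hxb] with y hy
    have := hC y (Icc_subset_uIcc hy)
    simp only [Pi.sub_apply] at this
    rw [← this]
    ring
  exact (((hderiv x hx).differentiableAt).const_add C).congr_of_eventuallyEq hEq

lemma slExpr_congr {f : ℝ → ℝ} {g h : ℝ → ℂ} (H : EqOn g h (Ioo 0 1)) :
    EqOn (slExpr f g) (slExpr f h) (Ioo 0 1) := by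
  intro x hx
  have h1 : EqOn (quasiDeriv g) (quasiDeriv h) (Ioo 0 1) := fun y hy => by
    simp only [quasiDeriv, (H.eventuallyEq_of_mem (isOpen_Ioo.mem_nhds hy)).deriv_eq]
  simp only [slExpr, (h1.eventuallyEq_of_mem (isOpen_Ioo.mem_nhds hx)).deriv_eq, H hx]

/-- Two admissible representatives of one class agree on `(0,1)`. -/
lemma IsDomainRep.eqOn {f : ℝ → ℝ} {u : WeightedL2} {g h : ℝ → ℂ} (hg : IsDomainRep f u g)
    (hh : IsDomainRep f u h) : EqOn g h (Ioo 0 1) := by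
  have h1 : g =ᵐ[weightMeasure] h := hg.ae_eq.symm.trans hh.ae_eq
  have h2 : g =ᵐ[volume.restrict (Ioo (0 : ℝ) 1)] h :=
    (ae_restrict_iff' measurableSet_Ioo).2 (ae_weightMeasure_iff.1 h1)
  exact Measure.eqOn_open_of_ae_eq h2 isOpen_Ioo hg.ac.continuousOn hh.ac.continuousOn

lemma quasiDeriv_add {f : ℝ → ℝ} {u v : WeightedL2} {g h : ℝ → ℂ} (hg : IsDomainRep f u g)
    (hh : IsDomainRep f v h) :
    EqOn (quasiDeriv (g + h)) (quasiDeriv g + quasiDeriv h) (Ioo 0 1) := by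
  intro x hx
  simp only [quasiDeriv, Pi.add_apply]
  rw [deriv_add (differentiableAt_of_isACLoc hg.ac hg.ac_quasiDeriv hx)
    (differentiableAt_of_isACLoc hh.ac hh.ac_quasiDeriv hx)]
  ring

lemma quasiDeriv_smul (c : ℂ) (g : ℝ → ℂ) : quasiDeriv (c • g) = c • quasiDeriv g := by
  funext x
  simp only [quasiDeriv, Pi.smul_apply, smul_eq_mul]
  rw [deriv_const_smul_field]
  simp only [smul_eq_mul]
  ring

lemma IsACLoc.congr {g h : ℝ → ℂ} (hg : IsACLoc g) (H : EqOn h g (Ioo 0 1)) : IsACLoc h := by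
  intro a b ha hab hb
  have hs : uIcc a b ⊆ Ioo (0 : ℝ) 1 := by
    rw [uIcc_of_le hab]
    exact fun y hy => ⟨by linarith [hy.1], by linarith [hy.2]⟩
  have h0 : AbsolutelyContinuousOnInterval (h - g) a b := by
    rw [absolutelyContinuousOnInterval_iff]
    intro ε hε
    refine ⟨1, one_pos, fun E hE _ => ?_⟩
    rw [Finset.sum_eq_zero]
    · exact hε
    · intro i hi
      have := hE.1 i hi
      simp [H (hs this.1), H (hs this.2)]
  simpa using h0.add (hg a b ha hab hb)

lemma slExpr_add {f : ℝ → ℝ} {u v : WeightedL2} {g h : ℝ → ℂ} (hg : IsDomainRep f u g)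
    (hh : IsDomainRep f v h) :
    slExpr f (g + h) =ᵐ[weightMeasure] slExpr f g + slExpr f h := by
  refine ae_weightMeasure_iff.2 ?_
  filter_upwards [hg.ac_quasiDeriv.ae_differentiableAt, hh.ac_quasiDeriv.ae_differentiableAt]
    with x h1 h2 hx
  simp only [slExpr, Pi.add_apply]
  rw [((quasiDeriv_add hg hh).eventuallyEq_of_mem (isOpen_Ioo.mem_nhds hx)).deriv_eq,
    deriv_add (h1 hx) (h2 hx)]
  ring

lemma slExpr_smul (f : ℝ → ℝ) (c : ℂ) (g : ℝ → ℂ) : slExpr f (c • g) = c • slExpr f g := by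
  funext x
  simp only [slExpr, quasiDeriv_smul, Pi.smul_apply, smul_eq_mul]
  rw [deriv_const_smul_field]
  simp only [smul_eq_mul]
  ring

lemma IsDomainRep.add {f : ℝ → ℝ} {u v : WeightedL2} {g h : ℝ → ℂ} (hg : IsDomainRep f u g)
    (hh : IsDomainRep f v h) : IsDomainRep f (u + v) (g + h) where
  ae_eq := (Lp.coeFn_add u v).trans (hg.ae_eq.add hh.ae_eq)
  ac a b h1 h2 h3 := (hg.ac a b h1 h2 h3).add (hh.ac a b h1 h2 h3)
  ac_quasiDeriv := IsACLoc.congr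
    (fun a b h1 h2 h3 => (hg.ac_quasiDeriv a b h1 h2 h3).add (hh.ac_quasiDeriv a b h1 h2 h3))
    (quasiDeriv_add hg hh)
  memLp := (memLp_congr_ae (slExpr_add hg hh)).2 (hg.memLp.add hh.memLp)

lemma IsDomainRep.smul {f : ℝ → ℝ} {u : WeightedL2} {g : ℝ → ℂ} (c : ℂ)
    (hg : IsDomainRep f u g) : IsDomainRep f (c • u) (c • g) where
  ae_eq := (Lp.coeFn_smul c u).trans (hg.ae_eq.const_smul c)
  ac a b h1 h2 h3 := (hg.ac a b h1 h2 h3).const_smul c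
  ac_quasiDeriv := by
    rw [quasiDeriv_smul]
    exact fun a b h1 h2 h3 => (hg.ac_quasiDeriv a b h1 h2 h3).const_smul c
  memLp := by
    rw [slExpr_smul]
    exact hg.memLp.const_smul c

lemma isDomainRep_zero (f : ℝ → ℝ) : IsDomainRep f 0 0 := by
  have hq : quasiDeriv (0 : ℝ → ℂ) = 0 := by simpa using quasiDeriv_smul 0 0
  have hs : slExpr f (0 : ℝ → ℂ) = 0 := by simpa using slExpr_smul f 0 0
  have h0 : IsACLoc 0 := fun a b _ _ _ =>
    (LipschitzWith.const (0 : ℂ)).lipschitzOnWith.absolutelyContinuousOnInterval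
  exact ⟨Lp.coeFn_zero _ _ _, h0, by rwa [hq], by rw [hs]; exact MemLp.zero⟩

/-- The maximal domain
`D(A) = {u ∈ H : u, p u' ∈ AC_loc(0,1), a u ∈ H}`. -/
def maximalDomain (f : ℝ → ℝ) : Submodule ℂ WeightedL2 where
  carrier := {u | ∃ g, IsDomainRep f u g}
  add_mem' := by
    rintro u v ⟨g, hg⟩ ⟨h, hh⟩
    exact ⟨g + h, hg.add hh⟩
  zero_mem' := ⟨0, isDomainRep_zero f⟩
  smul_mem' := by
    rintro c u ⟨g, hg⟩
    exact ⟨c • g, hg.smul c⟩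

lemma toLp_slExpr_eq {f : ℝ → ℝ} {u : WeightedL2} {g h : ℝ → ℂ} (hg : IsDomainRep f u g)
    (hh : IsDomainRep f u h) : hg.memLp.toLp (slExpr f g) = hh.memLp.toLp (slExpr f h) := by
  rw [MemLp.toLp_eq_toLp_iff]
  exact ae_weightMeasure_iff.2 (Eventually.of_forall fun x hx => slExpr_congr (hg.eqOn hh) hx)

/-- The maximal operator `A u = a u` on `D(A)`. -/
noncomputable def maximalOperator (f : ℝ → ℝ) : WeightedL2 →ₗ.[ℂ] WeightedL2 where
  domain := maximalDomain f
  toFun :=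
    { toFun := fun u => u.2.choose_spec.memLp.toLp (slExpr f u.2.choose)
      map_add' := fun u v => by
        have h := u.2.choose_spec.add v.2.choose_spec
        rw [← MemLp.toLp_add, toLp_slExpr_eq (u + v).2.choose_spec h, MemLp.toLp_eq_toLp_iff]
        exact slExpr_add u.2.choose_spec v.2.choose_spec
      map_smul' := fun c u => by
        have h := u.2.choose_spec.smul c
        rw [RingHom.id_apply, ← MemLp.toLp_const_smul, toLp_slExpr_eq (c • u).2.choose_spec h,
          MemLp.toLp_eq_toLp_iff, slExpr_smul] }

/-- `A u` is represented by `a g` for every admissible representative `g` of `u`. -/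
lemma maximalOperator_apply_ae_eq {f : ℝ → ℝ} (u : (maximalOperator f).domain) {g : ℝ → ℂ}
    (hg : IsDomainRep f u g) : maximalOperator f u =ᵐ[weightMeasure] slExpr f g := by
  have h : maximalOperator f u = hg.memLp.toLp (slExpr f g) := toLp_slExpr_eq u.2.choose_spec hg
  rw [h]
  exact hg.memLp.coeFn_toLp

/-! ### Classification of the endpoints -/

/-- `g` solves `a g = z g` on `(0,1)`: `g, p g' ∈ AC_loc(0,1)` and the equation holds a.e. -/
structure IsSolution (f : ℝ → ℝ) (z : ℂ) (g : ℝ → ℂ) : Prop where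
  ac : IsACLoc g
  ac_quasiDeriv : IsACLoc (quasiDeriv g)
  eqn : ∀ᵐ ρ, ρ ∈ Ioo (0 : ℝ) 1 → slExpr f g ρ = z * g ρ

/-- The endpoint `e` of `(0,1)` is in the limit-point case: for every spectral parameter `z` some
solution of `a g = z g` is not square integrable with weight `w` near `e`. -/
def IsLimitPoint (f : ℝ → ℝ) (e : ℝ) : Prop :=
  ∀ z : ℂ, ∃ g, IsSolution f z g ∧
    ¬ IntegrableAtFilter (fun ρ => ‖g ρ‖ ^ 2) (𝓝[Ioo 0 1] e) weightMeasure

/-- The endpoint `e` is a regular singular point of `a u = 0`, i.e. of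
`u'' + (p'/p) u' - (q/p) u = 0`, with Frobenius indices `r, s`: near `e` in `(0,1)` one has
`p'/p = b(ρ)/(ρ-e)` and `-q/p = c(ρ)/(ρ-e)²` with `b, c` analytic up to `e`, and the indicial
polynomial `x(x-1) + b(e) x + c(e)` has the roots `r, s`, counted with multiplicity. -/
def HasFrobeniusIndices (f : ℝ → ℝ) (e r s : ℝ) : Prop :=
  ∃ b c : ℝ → ℝ, AnalyticWithinAt ℝ b (Icc 0 1) e ∧ AnalyticWithinAt ℝ c (Icc 0 1) e ∧
    (∀ᶠ ρ in 𝓝[Ioo 0 1] e, deriv leadCoeff ρ / leadCoeff ρ = b ρ / (ρ - e) ∧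
      -(potential f ρ / leadCoeff ρ) = c ρ / (ρ - e) ^ 2) ∧
    ∀ x : ℝ, x * (x - 1) + b e * x + c e = (x - r) * (x - s)

end WaveMap

namespace WaveMap

/-! ### Absolutely continuous functions with values in a normed space -/

/-! The analysis rests on the bracket `g · p h' - p g' · h`. If `g`, `h`, `a g`, `a h` are square
integrable with weight `w` near an endpoint, the bracket cannot have a nonzero limit there. The
solutions of `a u = z u` with data `(1, 0)` and `(0, 1)` for `(u, p u')` at `1/2` have bracket
identically `1`, so one of them is not square integrable near the endpoint. This is the limit-point
case, for every `z` at once and without asymptotics of solutions. The same fact for the bracket with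
`g` conjugated removes the boundary terms in Green's formula, so the maximal operator is symmetric.
To serve both uses, the bracket lemmas only assume the bound `‖g‖ ‖p h'‖ + ‖p g'‖ ‖h‖`.

At `0` (`tendsto_bracket_zero`), `q = 2 + O(ρ²)` and `w` is comparable to `ρ²`. Up to this error the
equation splits into first-order ones: with `S = g' + 2g/ρ` one has `(ρ² g)' = ρ² S` and `ρ² S' = (q
- 2) g - w · a g`. Two integrations give `g = O(1)` and `p g' = O(ρ)`, which excludes the behaviour
`ρ⁻²`.

At `1` (`bracket_limit_eq_zero`), `q` and `w` are `O((1-ρ)⁻²)`. An energy estimate shows that `p g'`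
is square integrable, and so is `g/(1-ρ)`. Hence the bracket divided by `1-ρ` is integrable, which
no nonzero limit allows.

For self-adjointness, symmetry and density give `A ≤ A*`. Conversely, an element `v` of the domain
of `A*` solves the equation weakly. Tested against `φ/ρ`, this prescribes the second weak derivative
of `ρ v`, so `ρ v` is a double primitive plus an affine function (du Bois-Reymond), and `v` lies in
the maximal domain.

The Frobenius indices are read off the indicial polynomials `x² + x - 2` at `0` and `x² - x + 1/4`
at `1`. -/

lemma absolutelyContinuousOnInterval_comp_of_lipschitz {X Y : Type*} [PseudoMetricSpace X]
    [PseudoMetricSpace Y] {K : NNReal} {φ : X → Y} (hφ : LipschitzWith K φ) {g : ℝ → X} {a b : ℝ}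
    (hg : AbsolutelyContinuousOnInterval g a b) :
    AbsolutelyContinuousOnInterval (fun x => φ (g x)) a b := by
  rw [absolutelyContinuousOnInterval_iff] at hg ⊢
  intro ε hε
  -- Dividing by `K + 1` instead of `K` covers `K = 0`.
  obtain ⟨δ, hδ, h⟩ := hg (ε / (K + 1)) (by positivity)
  refine ⟨δ, hδ, fun E hE hE' => ?_⟩
  have h1 := h E hE hE'
  rw [lt_div_iff₀ (by positivity)] at h1
  calc ∑ i ∈ Finset.range E.1, dist (φ (g (E.2 i).1)) (φ (g (E.2 i).2))
      ≤ ∑ i ∈ Finset.range E.1, K * dist (g (E.2 i).1) (g (E.2 i).2) :=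
        Finset.sum_le_sum fun i _ => hφ.dist_le_mul _ _
    _ = K * ∑ i ∈ Finset.range E.1, dist (g (E.2 i).1) (g (E.2 i).2) := by rw [Finset.mul_sum]
    _ ≤ (∑ i ∈ Finset.range E.1, dist (g (E.2 i).1) (g (E.2 i).2)) * (K + 1) := by
        have : 0 ≤ ∑ i ∈ Finset.range E.1, dist (g (E.2 i).1) (g (E.2 i).2) :=
          Finset.sum_nonneg fun _ _ => dist_nonneg
        linarith
    _ < ε := h1

lemma absolutelyContinuousOnInterval_congr {X : Type*} [PseudoMetricSpace X] {g h : ℝ → X}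
    {a b : ℝ} (H : EqOn h g (uIcc a b)) (hg : AbsolutelyContinuousOnInterval g a b) :
    AbsolutelyContinuousOnInterval h a b := by
  rw [absolutelyContinuousOnInterval_iff] at hg ⊢
  intro ε hε
  obtain ⟨δ, hδ, hE⟩ := hg ε hε
  refine ⟨δ, hδ, fun E hE1 hE2 => ?_⟩
  rw [Finset.sum_congr rfl fun i hi => by rw [H (hE1.1 i hi).1, H (hE1.1 i hi).2]]
  exact hE E hE1 hE2

/-- Real and imaginary parts reduce this to real integrands; the embedding `ℝ → ℂ` is Lipschitz, so
the two primitives can be recombined. -/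
lemma absolutelyContinuousOnInterval_integral {k : ℝ → ℂ} {a b c : ℝ}
    (hk : IntervalIntegrable k volume a b) (hc : c ∈ uIcc a b) :
    AbsolutelyContinuousOnInterval (fun x => ∫ t in c..x, k t) a b := by
  have hre : IntervalIntegrable (fun x => (k x).re) volume a b :=
    ⟨hk.1.re, hk.2.re⟩
  have him : IntervalIntegrable (fun x => (k x).im) volume a b :=
    ⟨hk.1.im, hk.2.im⟩
  have h1 := absolutelyContinuousOnInterval_comp_of_lipschitz
    Complex.isometry_ofReal.lipschitz (hre.absolutelyContinuousOnInterval_intervalIntegral hc)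
  have h2 := (absolutelyContinuousOnInterval_comp_of_lipschitz
    Complex.isometry_ofReal.lipschitz
      (him.absolutelyContinuousOnInterval_intervalIntegral hc)).const_smul Complex.I
  refine absolutelyContinuousOnInterval_congr ?_ (h1.add h2)
  intro x hx
  have hkx : IntervalIntegrable k volume c x := hk.mono_set (uIcc_subset_uIcc hc hx)
  have e1 := Complex.reCLM.intervalIntegral_comp_comm hkx
  have e2 := Complex.imCLM.intervalIntegral_comp_comm hkx
  simp only [Complex.reCLM_apply, Complex.imCLM_apply] at e1 e2
  simp only [Pi.add_apply, e1, e2, smul_eq_mul]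
  rw [mul_comm, Complex.re_add_im]

/-! ### Calculus of locally absolutely continuous functions on `(0,1)`. -/

lemma Icc_subset_Ioo_zero_one {a b : ℝ} (ha : 0 < a) (hb : b < 1) : Icc a b ⊆ Ioo (0 : ℝ) 1 :=
  fun _ hy => ⟨ha.trans_le hy.1, hy.2.trans_lt hb⟩

lemma uIcc_subset_Ioo_zero_one {a b : ℝ} (ha : a ∈ Ioo (0 : ℝ) 1) (hb : b ∈ Ioo (0 : ℝ) 1) :
    uIcc a b ⊆ Ioo (0 : ℝ) 1 := ordConnected_Ioo.uIcc_subset ha hb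

/-- Countably many compact intervals exhaust `(0,1)`. The shift by `2` in the denominators makes all
of them nonempty. -/
lemma ae_Ioo_of_ae_Icc {P : ℝ → Prop}
    (h : ∀ a b : ℝ, 0 < a → a ≤ b → b < 1 → ∀ᵐ x, x ∈ Icc a b → P x) :
    ∀ᵐ x, x ∈ Ioo (0 : ℝ) 1 → P x := by
  have key : ∀ k : ℕ, ∀ᵐ ρ, ρ ∈ Icc (1 / ((k : ℝ) + 2)) (1 - 1 / ((k : ℝ) + 2)) → P ρ := by
    intro k
    have h2 : (1 : ℝ) / ((k : ℝ) + 2) ≤ 1 / 2 :=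
      one_div_le_one_div_of_le (by norm_num) (by linarith [Nat.cast_nonneg (α := ℝ) k])
    have h0 : (0 : ℝ) < 1 / ((k : ℝ) + 2) := by positivity
    exact h _ _ h0 (by linarith) (by linarith)
  filter_upwards [ae_all_iff.2 key] with ρ h hρ
  obtain ⟨k, hk⟩ := exists_nat_one_div_lt (lt_min hρ.1 (sub_pos.2 hρ.2))
  have hk' : (1 : ℝ) / ((k : ℝ) + 2) ≤ 1 / ((k : ℝ) + 1) :=
    one_div_le_one_div_of_le (by positivity) (by linarith)
  refine h k ⟨?_, ?_⟩
  · linarith [min_le_left ρ (1 - ρ)]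
  · linarith [min_le_right ρ (1 - ρ)]

lemma intervalIntegrable_of_locallyIntegrableOn {k : ℝ → ℂ}
    (hk : LocallyIntegrableOn k (Ioo 0 1)) {a b : ℝ} (ha : a ∈ Ioo (0 : ℝ) 1)
    (hb : b ∈ Ioo (0 : ℝ) 1) : IntervalIntegrable k volume a b :=
  (hk.integrableOn_compact_subset (uIcc_subset_Ioo_zero_one ha hb)
    isCompact_uIcc).intervalIntegrable

lemma isACLoc_of_forall {g : ℝ → ℂ}
    (h : ∀ a ∈ Ioo (0 : ℝ) 1, ∀ b ∈ Ioo (0 : ℝ) 1, AbsolutelyContinuousOnInterval g a b) :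
    IsACLoc g := fun a b h1 h2 h3 => h a ⟨h1, h2.trans_lt h3⟩ b ⟨h1.trans_le h2, h3⟩

lemma IsACLoc.acOn {g : ℝ → ℂ} (hg : IsACLoc g) {a b : ℝ} (ha : a ∈ Ioo (0 : ℝ) 1)
    (hb : b ∈ Ioo (0 : ℝ) 1) : AbsolutelyContinuousOnInterval g a b := by
  rcases le_total a b with h | h
  · exact hg a b ha.1 h hb.2
  · exact (hg b a hb.1 h ha.2).symm

lemma isACLoc_integral {k : ℝ → ℂ} (hk : LocallyIntegrableOn k (Ioo 0 1)) {c : ℝ}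
    (hc : c ∈ Ioo (0 : ℝ) 1) : IsACLoc fun x => ∫ t in c..x, k t := by
  refine isACLoc_of_forall fun a ha b hb => ?_
  have h1 : AbsolutelyContinuousOnInterval (fun x => ∫ t in a..x, k t) a b :=
    absolutelyContinuousOnInterval_integral (intervalIntegrable_of_locallyIntegrableOn hk ha hb)
      left_mem_uIcc
  have h2 : AbsolutelyContinuousOnInterval (fun _ : ℝ => ∫ t in c..a, k t) a b :=
    (LipschitzWith.const _).lipschitzOnWith.absolutelyContinuousOnInterval
  refine absolutelyContinuousOnInterval_congr ?_ (h2.add h1)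
  intro x hx
  have hx' := uIcc_subset_Ioo_zero_one ha hb hx
  simp only [Pi.add_apply]
  exact (intervalIntegral.integral_add_adjacent_intervals
    (intervalIntegrable_of_locallyIntegrableOn hk hc ha)
    (intervalIntegrable_of_locallyIntegrableOn hk ha hx')).symm

lemma ae_hasDerivAt_integral {k : ℝ → ℂ} (hk : LocallyIntegrableOn k (Ioo 0 1)) {c : ℝ}
    (hc : c ∈ Ioo (0 : ℝ) 1) :
    ∀ᵐ x, x ∈ Ioo (0 : ℝ) 1 → HasDerivAt (fun x => ∫ t in c..x, k t) (k x) x := by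
  refine ae_Ioo_of_ae_Icc fun a b ha hab hb => ?_
  have ha' : min a c ∈ Ioo (0 : ℝ) 1 := ⟨lt_min ha hc.1, (min_le_right _ _).trans_lt hc.2⟩
  have hb' : max b c ∈ Ioo (0 : ℝ) 1 := ⟨hc.1.trans_le (le_max_right _ _), max_lt hb hc.2⟩
  have h := (intervalIntegrable_of_locallyIntegrableOn hk ha' hb').ae_hasDerivAt_integral
  filter_upwards [h] with x hx hxab
  refine hx (Icc_subset_uIcc ⟨(min_le_left _ _).trans hxab.1, hxab.2.trans (le_max_left _ _)⟩) c
    (Icc_subset_uIcc ⟨min_le_right _ _, le_max_right _ _⟩)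

/-- Fundamental theorem of calculus for locally absolutely continuous functions. -/
lemma IsACLoc.integral_eq_sub {F F' : ℝ → ℂ} (hF : IsACLoc F)
    (hF' : ∀ᵐ x, x ∈ Ioo (0 : ℝ) 1 → HasDerivAt F (F' x) x)
    (hI : LocallyIntegrableOn F' (Ioo 0 1)) {a b : ℝ} (ha : a ∈ Ioo (0 : ℝ) 1)
    (hb : b ∈ Ioo (0 : ℝ) 1) : ∫ x in a..b, F' x = F b - F a := by
  have hG := (hF.acOn ha hb).sub ((isACLoc_integral hI ha).acOn ha hb)
  obtain ⟨C, hC⟩ := hG.const_of_ae_hasDerivAt_zero (by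
    filter_upwards [hF', ae_hasDerivAt_integral hI ha] with x h1 h2 hx
    have hx' := uIcc_subset_Ioo_zero_one ha hb hx
    simpa using (h1 hx').sub (h2 hx'))
  have h1 := hC a left_mem_uIcc
  have h2 := hC b right_mem_uIcc
  simp only [Pi.sub_apply, intervalIntegral.integral_same, sub_zero] at h1 h2
  rw [h1, ← h2]
  ring

lemma IsACLoc.mul {g h : ℝ → ℂ} (hg : IsACLoc g) (hh : IsACLoc h) :
    IsACLoc fun x => g x * h x := fun a b h1 h2 h3 => by
  exact (hg a b h1 h2 h3).smul (hh a b h1 h2 h3)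

lemma IsACLoc.add {g h : ℝ → ℂ} (hg : IsACLoc g) (hh : IsACLoc h) :
    IsACLoc fun x => g x + h x := fun a b h1 h2 h3 => (hg a b h1 h2 h3).add (hh a b h1 h2 h3)

lemma IsACLoc.sub {g h : ℝ → ℂ} (hg : IsACLoc g) (hh : IsACLoc h) :
    IsACLoc fun x => g x - h x := fun a b h1 h2 h3 => (hg a b h1 h2 h3).sub (hh a b h1 h2 h3)

lemma IsACLoc.conj {g : ℝ → ℂ} (hg : IsACLoc g) : IsACLoc fun x => star (g x) :=
  fun a b h1 h2 h3 => absolutelyContinuousOnInterval_comp_of_lipschitz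
    (starₗᵢ ℂ : ℂ ≃ₗᵢ⋆[ℂ] ℂ).lipschitz (hg a b h1 h2 h3)

lemma isACLoc_of_contDiffOn {g : ℝ → ℂ} (hg : ContDiffOn ℝ 1 g (Ioo 0 1)) : IsACLoc g :=
  isACLoc_of_forall fun _ ha _ hb =>
    (hg.mono (uIcc_subset_Ioo_zero_one ha hb)).absolutelyContinuousOnInterval

lemma isACLoc_of_hasDerivAt {g g' : ℝ → ℂ} (h : ∀ x ∈ Ioo (0 : ℝ) 1, HasDerivAt g (g' x) x)
    (hc : ContinuousOn g' (Ioo 0 1)) : IsACLoc g := by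
  refine isACLoc_of_contDiffOn ?_
  rw [contDiffOn_one_iff_derivWithin isOpen_Ioo.uniqueDiffOn]
  refine ⟨fun y hy => (h y hy).differentiableAt.differentiableWithinAt, hc.congr fun y hy => ?_⟩
  rw [derivWithin_of_isOpen isOpen_Ioo hy, (h y hy).deriv]

lemma IsACLoc.locallyIntegrableOn {g : ℝ → ℂ} (hg : IsACLoc g) :
    LocallyIntegrableOn g (Ioo 0 1) :=
  hg.continuousOn.locallyIntegrableOn measurableSet_Ioo

lemma locallyIntegrableOn_mul_continuousOn {g h : ℝ → ℂ}
    (hg : LocallyIntegrableOn g (Ioo 0 1)) (hh : ContinuousOn h (Ioo 0 1)) :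
    LocallyIntegrableOn (fun x => g x * h x) (Ioo 0 1) := by
  simpa [mul_comm] using hg.continuousOn_smul isOpen_Ioo.isLocallyClosed hh

/-! ### Test functions and the lemma of du Bois-Reymond -/

/-- Smooth real functions with compact support in `(0,1)`. -/
structure IsTest (φ : ℝ → ℝ) : Prop where
  contDiff : ContDiff ℝ (⊤ : ℕ∞) φ
  compact : HasCompactSupport φ
  subset : tsupport φ ⊆ Ioo 0 1

lemma IsTest.deriv {φ : ℝ → ℝ} (hφ : IsTest φ) : IsTest (deriv φ) where
  contDiff := (contDiff_infty_iff_deriv.1 hφ.contDiff).2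
  compact := hφ.compact.deriv
  subset := tsupport_deriv_subset.trans hφ.subset

lemma IsTest.sub_const_mul {φ ψ : ℝ → ℝ} (hφ : IsTest φ) (hψ : IsTest ψ) (c : ℝ) :
    IsTest fun x => φ x - c * ψ x := by
  have hs : tsupport (fun x => φ x - c * ψ x) ⊆ tsupport φ ∪ tsupport ψ := by
    refine closure_minimal (fun x hx => ?_) ((isClosed_tsupport _).union (isClosed_tsupport _))
    by_contra h
    rw [mem_union, not_or] at h
    exact hx (by simp [image_eq_zero_of_notMem_tsupport h.1, image_eq_zero_of_notMem_tsupport h.2])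
  refine ⟨hφ.contDiff.sub (contDiff_const.mul hψ.contDiff), ?_,
    hs.trans (union_subset hφ.subset hψ.subset)⟩
  exact (hφ.compact.isCompact.union hψ.compact.isCompact).of_isClosed_subset
    (isClosed_tsupport _) hs

lemma IsTest.hasDerivAt {φ : ℝ → ℝ} (hφ : IsTest φ) (x : ℝ) : HasDerivAt φ (_root_.deriv φ x) x :=
  ((hφ.contDiff.differentiable (by simp)) x).hasDerivAt

lemma IsTest.exists_Icc {φ : ℝ → ℝ} (hφ : IsTest φ) :
    ∃ a b : ℝ, 0 < a ∧ a < b ∧ b < 1 ∧ ∀ x, x ∉ Ioo a b → φ x = 0 := by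
  obtain ⟨a, b, ha, hab, hb, h⟩ : ∃ a b : ℝ, 0 < a ∧ a < b ∧ b < 1 ∧ tsupport φ ⊆ Ioo a b := by
    rcases (tsupport φ).eq_empty_or_nonempty with h | h
    · exact ⟨1 / 4, 1 / 2, by norm_num, by norm_num, by norm_num, by simp [h]⟩
    · obtain ⟨m, hm, hm'⟩ := hφ.compact.isCompact.exists_isLeast h
      obtain ⟨M, hM, hM'⟩ := hφ.compact.isCompact.exists_isGreatest h
      have h1 := hφ.subset hm
      have h2 := hφ.subset hM
      have h3 := hm' hM
      refine ⟨m / 2, (M + 1) / 2, by linarith [h1.1], by linarith [h1.1, h2.2],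
        by linarith [h2.2], fun x hx => ⟨?_, ?_⟩⟩
      · linarith [hm' hx, h1.1]
      · linarith [hM' hx, h2.2]
  exact ⟨a, b, ha, hab, hb, fun x hx => image_eq_zero_of_notMem_tsupport fun h' => hx (h h')⟩

lemma exists_isTest_integral_eq_one : ∃ η : ℝ → ℝ, IsTest η ∧ ∫ x, η x = 1 := by
  let B : ContDiffBump (1 / 2 : ℝ) := ⟨1 / 8, 1 / 4, by norm_num, by norm_num⟩
  refine ⟨B.normed volume, ⟨B.contDiff_normed, B.hasCompactSupport_normed, ?_⟩, B.integral_normed⟩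
  rw [B.tsupport_normed_eq, Real.closedBall_eq_Icc]
  exact Icc_subset_Ioo_zero_one (by norm_num [B]) (by norm_num [B])

lemma IsTest.exists_primitive {ψ : ℝ → ℝ} (hψ : IsTest ψ) (h0 : ∫ x, ψ x = 0) :
    ∃ φ, IsTest φ ∧ _root_.deriv φ = ψ := by
  obtain ⟨a, b, ha, hab, hb, hz⟩ := hψ.exists_Icc
  have hc := hψ.contDiff.continuous
  have hd : ∀ x, HasDerivAt (fun x => ∫ t in a..x, ψ t) (ψ x) x := fun x =>
    (hc.integral_hasStrictDerivAt a x).hasDerivAt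
  have hd' : _root_.deriv (fun x => ∫ t in a..x, ψ t) = ψ := funext fun x => (hd x).deriv
  have hsupp : ∀ x, x ∉ Icc a b → (∫ t in a..x, ψ t) = 0 := by
    intro x hx
    rcases lt_or_ge x a with h | h
    · refine intervalIntegral.integral_zero_ae (Eventually.of_forall fun t ht => hz t fun ht' => ?_)
      rw [uIoc_of_ge h.le] at ht
      exact absurd ht'.1 (not_lt.2 ht.2)
    · have hx' : b < x := by
        by_contra h'
        exact hx ⟨h, not_lt.1 h'⟩
      rw [intervalIntegral.integral_eq_integral_of_support_subset, h0]
      intro t ht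
      by_contra h'
      exact ht (hz t fun h'' => h' ⟨h''.1, (h''.2.trans hx').le⟩)
  have hts : tsupport (fun x => ∫ t in a..x, ψ t) ⊆ Icc a b := by
    refine closure_minimal (fun x hx => ?_) isClosed_Icc
    by_contra h
    exact hx (hsupp x h)
  refine ⟨_, ⟨?_, isCompact_Icc.of_isClosed_subset (isClosed_tsupport _) hts,
    hts.trans (Icc_subset_Ioo_zero_one ha hb)⟩, hd'⟩
  rw [contDiff_infty_iff_deriv, hd']
  exact ⟨fun x => (hd x).differentiableAt, hψ.contDiff⟩

lemma IsTest.isACLoc {φ : ℝ → ℝ} (hφ : IsTest φ) : IsACLoc fun x => (φ x : ℂ) :=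
  isACLoc_of_hasDerivAt (fun x _ => (hφ.hasDerivAt x).ofReal_comp)
    (Complex.continuous_ofReal.comp hφ.deriv.contDiff.continuous).continuousOn

lemma IsTest.integrable_mul {φ : ℝ → ℝ} (hφ : IsTest φ) {g : ℝ → ℂ}
    (hg : LocallyIntegrableOn g (Ioo 0 1)) : Integrable fun x => (φ x : ℂ) * g x := by
  obtain ⟨a, b, ha, hab, hb, hz⟩ := hφ.exists_Icc
  have h1 : IntegrableOn g (Icc a b) :=
    hg.integrableOn_compact_subset (Icc_subset_Ioo_zero_one ha hb) isCompact_Icc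
  have h2 : IntegrableOn (fun x => (φ x : ℂ) * g x) (Icc a b) :=
    h1.continuousOn_mul (Complex.continuous_ofReal.comp hφ.contDiff.continuous).continuousOn
      isCompact_Icc
  refine (integrableOn_iff_integrable_of_support_subset fun x hx => ?_).1 h2
  by_contra h
  exact hx (by simp [hz x fun h' => h (Ioo_subset_Icc_self h')])

/-- Integration by parts against a test function. -/
lemma IsTest.integral_deriv_mul {φ : ℝ → ℝ} (hφ : IsTest φ) {F F' : ℝ → ℂ} (hF : IsACLoc F)
    (hF' : ∀ᵐ x, x ∈ Ioo (0 : ℝ) 1 → HasDerivAt F (F' x) x)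
    (hI : LocallyIntegrableOn F' (Ioo 0 1)) :
    ∫ x, ((_root_.deriv φ x : ℝ) : ℂ) * F x = -∫ x, (φ x : ℂ) * F' x := by
  have hi1 := hφ.deriv.integrable_mul hF.locallyIntegrableOn
  have hi2 := hφ.integrable_mul hI
  rw [eq_neg_iff_add_eq_zero, ← integral_add hi1 hi2]
  obtain ⟨a, b, ha, hab, hb, hz⟩ := hφ.exists_Icc
  have hz' : ∀ x, x ∉ Icc a b → _root_.deriv φ x = 0 := by
    intro x hx
    have : φ =ᶠ[𝓝 x] fun _ => 0 := by
      filter_upwards [isClosed_Icc.isOpen_compl.mem_nhds hx] with y hy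
      exact hz y fun h => hy (Ioo_subset_Icc_self h)
    rw [this.deriv_eq, deriv_const]
  have h1 := (hφ.isACLoc.mul hF).integral_eq_sub
    (F' := fun x => ((_root_.deriv φ x : ℝ) : ℂ) * F x + (φ x : ℂ) * F' x) (by
      filter_upwards [hF'] with x hx hx'
      exact (hφ.hasDerivAt x).ofReal_comp.mul (hx hx'))
    ((hi1.add hi2).locallyIntegrable.locallyIntegrableOn _)
    (a := a / 2) (b := (b + 1) / 2) ⟨by linarith, by linarith⟩ ⟨by linarith, by linarith⟩
  rw [hz (a / 2) fun h => by linarith [h.1], hz ((b + 1) / 2) fun h => by linarith [h.2]] at h1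
  rw [intervalIntegral.integral_eq_integral_of_support_subset] at h1
  · simpa using h1
  · intro x hx
    by_contra h
    have : x ∉ Icc a b := fun h' => h ⟨by linarith [h'.1], by linarith [h'.2]⟩
    exact hx (by simp [hz' x this, hz x fun h' => this (Ioo_subset_Icc_self h')])

lemma ae_eq_zero_of_forall_isTest {g : ℝ → ℂ} (hg : LocallyIntegrableOn g (Ioo 0 1))
    (h : ∀ φ, IsTest φ → ∫ x, (φ x : ℂ) * g x = 0) : ∀ᵐ x, x ∈ Ioo (0 : ℝ) 1 → g x = 0 := by
  refine isOpen_Ioo.ae_eq_zero_of_integral_contDiff_smul_eq_zero hg fun φ h1 h2 h3 => ?_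
  simpa using h φ ⟨h1, h2, h3⟩

/-- A locally integrable function with vanishing weak derivative is constant. -/
lemma exists_ae_eq_const {g : ℝ → ℂ} (hg : LocallyIntegrableOn g (Ioo 0 1))
    (h : ∀ φ, IsTest φ → ∫ x, ((deriv φ x : ℝ) : ℂ) * g x = 0) :
    ∃ c : ℂ, ∀ᵐ x, x ∈ Ioo (0 : ℝ) 1 → g x = c := by
  obtain ⟨η, hη, hη1⟩ := exists_isTest_integral_eq_one
  set c : ℂ := ∫ x, (η x : ℂ) * g x with hc
  have hcI : LocallyIntegrableOn (fun _ : ℝ => c) (Ioo 0 1) :=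
    continuousOn_const.locallyIntegrableOn measurableSet_Ioo
  refine ⟨c, ?_⟩
  have := ae_eq_zero_of_forall_isTest (g := fun x => g x - c) (hg.sub hcI) fun ψ hψ => by
    have hI1 : Integrable ψ := hψ.contDiff.continuous.integrable_of_hasCompactSupport hψ.compact
    have hI2 : Integrable η := hη.contDiff.continuous.integrable_of_hasCompactSupport hη.compact
    -- Subtracting `(∫ ψ) η` makes the integral vanish, so the result is the derivative of a test
    -- function and the hypothesis reads `∫ ψ g = c ∫ ψ`.
    obtain ⟨φ, hφ, hφ'⟩ := (hψ.sub_const_mul hη (∫ x, ψ x)).exists_primitive (by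
      rw [integral_sub hI1 (hI2.const_mul _), integral_const_mul, hη1]
      ring)
    have h1 := h φ hφ
    rw [hφ'] at h1
    have h2 : ∀ x, ((ψ x - (∫ x, ψ x) * η x : ℝ) : ℂ) * g x
        = (ψ x : ℂ) * g x - ((∫ x, ψ x : ℝ) : ℂ) * ((η x : ℂ) * g x) := fun x => by
      push_cast
      ring
    simp only [h2] at h1
    rw [integral_sub (hψ.integrable_mul hg) ((hη.integrable_mul hg).const_mul _),
      integral_const_mul, ← hc] at h1
    simp only [mul_sub]
    have hI3 : Integrable fun x => (ψ x : ℂ) * c := hI1.ofReal.mul_const c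
    rw [integral_sub (hψ.integrable_mul hg) hI3, integral_mul_const, integral_complex_ofReal]
    exact h1
  filter_upwards [this] with x hx hx'
  exact sub_eq_zero.1 (hx hx')

/-- A locally integrable function with vanishing second weak derivative is affine. -/
lemma exists_ae_eq_affine {g : ℝ → ℂ} (hg : LocallyIntegrableOn g (Ioo 0 1))
    (h : ∀ φ, IsTest φ → ∫ x, ((deriv (deriv φ) x : ℝ) : ℂ) * g x = 0) :
    ∃ c d : ℂ, ∀ᵐ x : ℝ, x ∈ Ioo (0 : ℝ) 1 → g x = c + d * x := by
  obtain ⟨η, hη, hη1⟩ := exists_isTest_integral_eq_one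
  set d : ℂ := ∫ x, ((deriv η x : ℝ) : ℂ) * g x with hd
  have hlin : IsACLoc fun x : ℝ => d * (x : ℂ) :=
    isACLoc_of_contDiffOn (contDiff_const.mul Complex.ofRealCLM.contDiff).contDiffOn
  -- The same decomposition gives `∫ ψ' g = d ∫ ψ`. Since `∫ ψ' x = -∫ ψ`, the function `g + d x`
  -- has vanishing weak derivative.
  obtain ⟨c, hc⟩ := exists_ae_eq_const (g := fun x => g x + d * x)
    (hg.add hlin.locallyIntegrableOn) fun ψ hψ => by
    have hI1 : Integrable ψ := hψ.contDiff.continuous.integrable_of_hasCompactSupport hψ.compact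
    have hI2 : Integrable η := hη.contDiff.continuous.integrable_of_hasCompactSupport hη.compact
    obtain ⟨φ, hφ, hφ'⟩ := (hψ.sub_const_mul hη (∫ x, ψ x)).exists_primitive (by
      rw [integral_sub hI1 (hI2.const_mul _), integral_const_mul, hη1]
      ring)
    have h1 := h φ hφ
    rw [hφ'] at h1
    have h2 : ∀ x, ((deriv (fun x => ψ x - (∫ x, ψ x) * η x) x : ℝ) : ℂ) * g x
        = ((deriv ψ x : ℝ) : ℂ) * g x - ((∫ x, ψ x : ℝ) : ℂ) * (((deriv η x : ℝ) : ℂ) * g x) :=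
      fun x => by
      have h3 : HasDerivAt (fun x => ψ x - (∫ x, ψ x) * η x) _ x :=
        (hψ.hasDerivAt x).sub ((hη.hasDerivAt x).const_mul _)
      rw [h3.deriv]
      push_cast
      ring
    simp only [h2] at h1
    rw [integral_sub (hψ.deriv.integrable_mul hg) ((hη.deriv.integrable_mul hg).const_mul _),
      integral_const_mul, ← hd] at h1
    have h3 := hψ.integral_deriv_mul (F' := fun _ => d) hlin
      (Eventually.of_forall fun x _ => by
        simpa using (Complex.ofRealCLM.hasDerivAt (x := x)).const_mul d)
      (continuousOn_const.locallyIntegrableOn measurableSet_Ioo)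
    simp only [mul_add]
    rw [integral_add (hψ.deriv.integrable_mul hg)
      (hψ.deriv.integrable_mul hlin.locallyIntegrableOn), h3, integral_mul_const,
      integral_complex_ofReal]
    linear_combination h1
  refine ⟨c, -d, ?_⟩
  filter_upwards [hc] with x hx hx'
  linear_combination hx hx'

/-! ### Global solutions of ordinary differential equations -/

open Real in
/-- A continuous vector field that is Lipschitz in space with a continuous constant, and that
vanishes at the origin, has global solutions. -/
theorem exists_hasDerivAt_of_lipschitz {E : Type*} [NormedAddCommGroup E] [NormedSpace ℝ E]
    [CompleteSpace E] {v : ℝ → E → E} {K : ℝ → ℝ} (hv : Continuous fun p : ℝ × E => v p.1 p.2)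
    (hK : Continuous K) (hK0 : ∀ t, 0 ≤ K t) (hL : ∀ t x y, ‖v t x - v t y‖ ≤ K t * ‖x - y‖)
    (h0 : ∀ t, v t 0 = 0) (t₀ : ℝ) (y₀ : E) :
    ∃ y : ℝ → E, y t₀ = y₀ ∧ ∀ t, HasDerivAt y (v t (y t)) t := by
  -- Picard iteration for `y = m • g` with `g` bounded. From `N' = 2K` and `m = cosh N` follows `∫ K
  -- m = sinh N / 2`, at most `m / 2` in absolute value on both sides of `t₀`. So the integral
  -- operator contracts by `1/2` on the whole line at once. Unlike `exp |N|`, the weight `cosh N` is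
  -- differentiable wherever `N` is.
  set N : ℝ → ℝ := fun t => 2 * ∫ s in t₀..t, K s with hN
  have hNd : ∀ t, HasDerivAt N (2 * K t) t := fun t =>
    ((hK.integral_hasStrictDerivAt t₀ t).hasDerivAt).const_mul 2
  have hNc : Continuous N := continuous_iff_continuousAt.2 fun t => (hNd t).continuousAt
  set m : ℝ → ℝ := fun t => cosh (N t) with hm
  have hmc : Continuous m := continuous_cosh.comp hNc
  have hm1 : ∀ t, 1 ≤ m t := fun t => one_le_cosh _
  have hm0 : ∀ t, 0 < m t := fun t => cosh_pos _
  have hint : ∀ t, ∫ s in t₀..t, K s * m s = sinh (N t) / 2 := by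
    intro t
    have hd : ∀ s, HasDerivAt (fun s => sinh (N s) / 2) (K s * m s) s := fun s => by
      convert! ((hNd s).sinh).div_const 2 using 1
      simp only [hm]
      ring
    rw [intervalIntegral.integral_eq_sub_of_hasDerivAt (fun s _ => hd s)
      ((hK.mul hmc).intervalIntegrable _ _)]
    simp [hN]
  have hcomp : ∀ g : ℝ → E, Continuous g → Continuous fun s => v s (m s • g s) := fun g hg =>
    hv.comp (continuous_id.prodMk (hmc.smul hg))
  have key : ∀ (F : ℝ → E) (C : ℝ), 0 ≤ C → (∀ s, ‖F s‖ ≤ C * (K s * m s)) →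
      ∀ t, (m t)⁻¹ * ‖∫ s in t₀..t, F s‖ ≤ C / 2 := by
    intro F C hC0 hF t
    have h1 : ‖∫ s in t₀..t, F s‖ ≤ |∫ s in t₀..t, C * (K s * m s)| :=
      intervalIntegral.norm_integral_le_abs_of_norm_le (Eventually.of_forall fun s => hF s)
        ((continuous_const.mul (hK.mul hmc)).intervalIntegrable _ _)
    rw [intervalIntegral.integral_const_mul, hint, abs_mul, abs_of_nonneg hC0] at h1
    have h2 : |sinh (N t) / 2| ≤ m t / 2 := by
      rw [abs_div, abs_two]
      gcongr
      rw [abs_le]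
      exact ⟨by linarith [sinh_lt_cosh (-N t), sinh_neg (N t), cosh_neg (N t)],
        (sinh_lt_cosh _).le⟩
    rw [inv_mul_le_iff₀ (hm0 t)]
    calc _ ≤ C * |sinh (N t) / 2| := h1
      _ ≤ C * (m t / 2) := by gcongr
      _ = m t * (C / 2) := by ring
  have hbound : ∀ g : BoundedContinuousFunction ℝ E, ∀ t,
      ‖(m t)⁻¹ • (y₀ + ∫ s in t₀..t, v s (m s • g s))‖ ≤ ‖y₀‖ + ‖g‖ / 2 := by
    intro g t
    rw [norm_smul, norm_inv, Real.norm_of_nonneg (hm0 t).le]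
    -- As `v s 0 = 0`, the Lipschitz bound is a linear growth bound; hence the iteration preserves
    -- bounded functions.
    have h1 := key (fun s => v s (m s • g s)) ‖g‖ (norm_nonneg _) (fun s => by
      have := hL s (m s • g s) 0
      rw [h0, sub_zero, sub_zero, norm_smul, Real.norm_of_nonneg (hm0 s).le] at this
      calc _ ≤ _ := this
        _ ≤ K s * (m s * ‖g‖) := by
          have := hK0 s
          have := (hm0 s).le
          gcongr
          exact g.norm_coe_le_norm s
        _ = _ := by ring) t
    have h2 : (m t)⁻¹ ≤ 1 := inv_le_one_of_one_le₀ (hm1 t)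
    have h3 : 0 ≤ (m t)⁻¹ := (inv_pos.2 (hm0 t)).le
    calc (m t)⁻¹ * ‖y₀ + ∫ s in t₀..t, v s (m s • g s)‖
        ≤ (m t)⁻¹ * (‖y₀‖ + ‖∫ s in t₀..t, v s (m s • g s)‖) := by
          gcongr
          exact norm_add_le _ _
      _ ≤ 1 * ‖y₀‖ + ‖g‖ / 2 := by
          rw [mul_add]
          gcongr
      _ = _ := by ring
  have hTc : ∀ g : BoundedContinuousFunction ℝ E,
      Continuous fun t => (m t)⁻¹ • (y₀ + ∫ s in t₀..t, v s (m s • g s)) := fun g =>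
    (hmc.inv₀ fun t => (hm0 t).ne').smul (continuous_const.add
      (continuous_iff_continuousAt.2 fun t =>
        ((hcomp g g.continuous).integral_hasStrictDerivAt t₀ t).hasDerivAt.continuousAt))
  let T : BoundedContinuousFunction ℝ E → BoundedContinuousFunction ℝ E := fun g =>
    BoundedContinuousFunction.ofNormedAddCommGroup _ (hTc g) _ (hbound g)
  have hT : ContractingWith (1 / 2) T := by
    refine ⟨by norm_num, LipschitzWith.of_dist_le_mul fun g h => ?_⟩
    have hgh : 0 ≤ dist g h := dist_nonneg
    refine (BoundedContinuousFunction.dist_le (by positivity)).2 fun t => ?_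
    have h1 := key (fun s => v s (m s • g s) - v s (m s • h s)) (dist g h) hgh (fun s => by
      have := hL s (m s • g s) (m s • h s)
      rw [← smul_sub, norm_smul, Real.norm_of_nonneg (hm0 s).le] at this
      calc _ ≤ _ := this
        _ ≤ K s * (m s * dist g h) := by
          have := hK0 s
          have := (hm0 s).le
          gcongr
          rw [← dist_eq_norm]
          exact g.dist_coe_le_dist s
        _ = _ := by ring) t
    rw [intervalIntegral.integral_sub ((hcomp g g.continuous).intervalIntegrable _ _)
      ((hcomp h h.continuous).intervalIntegrable _ _)] at h1
    have h2 : T g t - T h t = (m t)⁻¹ • ((∫ s in t₀..t, v s (m s • g s))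
        - ∫ s in t₀..t, v s (m s • h s)) := by
      simp only [T, BoundedContinuousFunction.coe_ofNormedAddCommGroup, ← smul_sub]
      congr 1
      abel
    rw [dist_eq_norm, h2, norm_smul, norm_inv, Real.norm_of_nonneg (hm0 t).le]
    refine h1.trans (le_of_eq ?_)
    push_cast
    ring
  obtain ⟨g, hg⟩ : ∃ g, T g = g := ⟨_, hT.fixedPoint_isFixedPt⟩
  have hgt : ∀ t, m t • g t = y₀ + ∫ s in t₀..t, v s (m s • g s) := fun t => by
    conv_lhs => rw [← hg]
    simp only [T, BoundedContinuousFunction.coe_ofNormedAddCommGroup]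
    rw [smul_inv_smul₀ (hm0 t).ne']
  refine ⟨fun t => m t • g t, (hgt t₀).trans (by simp), fun t => ?_⟩
  have h1 := ((hcomp g g.continuous).integral_hasStrictDerivAt t₀ t).hasDerivAt.const_add y₀
  exact h1.congr_of_eventuallyEq (Eventually.of_forall hgt)

/-- Version of `exists_hasDerivAt_of_lipschitz` on the interval `(0,1)`. -/
theorem exists_hasDerivAt_Ioo {E : Type*} [NormedAddCommGroup E] [NormedSpace ℝ E]
    [CompleteSpace E] {v : ℝ → E → E} {K : ℝ → ℝ}
    (hv : ContinuousOn (fun p : ℝ × E => v p.1 p.2) (Ioo 0 1 ×ˢ univ))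
    (hK : ContinuousOn K (Ioo 0 1)) (hK0 : ∀ t ∈ Ioo (0 : ℝ) 1, 0 ≤ K t)
    (hL : ∀ t ∈ Ioo (0 : ℝ) 1, ∀ x y, ‖v t x - v t y‖ ≤ K t * ‖x - y‖)
    (h0 : ∀ t ∈ Ioo (0 : ℝ) 1, v t 0 = 0) (t₀ : ℝ) (y₀ : E) :
    ∃ y : ℝ → E, y t₀ = y₀ ∧ ∀ t ∈ Ioo (0 : ℝ) 1, HasDerivAt y (v t (y t)) t := by
  -- The logistic function maps `ℝ` onto `(0,1)`, with inverse `τ` and `σ' = σ (1 - σ)`. Pulling the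
  -- equation back gives a vector field on the whole line.
  let σ : ℝ → ℝ := fun s => (1 + Real.exp (-s))⁻¹
  let τ : ℝ → ℝ := fun t => -Real.log (t⁻¹ - 1)
  have hσc : Continuous σ := by
    refine Continuous.inv₀ (by fun_prop) fun s => ?_
    positivity
  have hσ : ∀ s, σ s ∈ Ioo (0 : ℝ) 1 := fun s =>
    ⟨by positivity, inv_lt_one_of_one_lt₀ (by linarith [Real.exp_pos (-s)])⟩
  have hpos : ∀ t ∈ Ioo (0 : ℝ) 1, 0 < t⁻¹ - 1 := fun t ht =>
    sub_pos.2 ((one_lt_inv₀ ht.1).2 ht.2)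
  have hστ : ∀ t ∈ Ioo (0 : ℝ) 1, σ (τ t) = t := fun t ht => by
    simp [σ, τ, Real.exp_log (hpos t ht)]
  have hτd : ∀ t ∈ Ioo (0 : ℝ) 1, HasDerivAt τ (t * (1 - t))⁻¹ t := fun t ht => by
    have h1 := (((hasDerivAt_inv ht.1.ne').sub_const 1).log (hpos t ht).ne').neg
    refine h1.congr_deriv ?_
    have := ht.1.ne'
    have := (sub_pos.2 ht.2).ne'
    have h3 : t⁻¹ - 1 = (1 - t) / t := by field_simp
    rw [h3]
    field_simp
  have hd0 : ∀ s, 0 ≤ σ s * (1 - σ s) := fun s =>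
    mul_nonneg (hσ s).1.le (sub_nonneg.2 (hσ s).2.le)
  obtain ⟨z, hz0, hz⟩ := exists_hasDerivAt_of_lipschitz
    (v := fun s x => (σ s * (1 - σ s)) • v (σ s) x)
    (K := fun s => (σ s * (1 - σ s)) * K (σ s)) (by
      refine Continuous.smul (by fun_prop) ?_
      exact hv.comp_continuous (f := fun p : ℝ × E => (σ p.1, p.2)) (by fun_prop)
        fun p => ⟨hσ p.1, mem_univ _⟩)
    ((hσc.mul (continuous_const.sub hσc)).mul (hK.comp_continuous hσc hσ))
    (fun s => mul_nonneg (hd0 s) (hK0 _ (hσ s)))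
    (fun s x y => by
      rw [← smul_sub, norm_smul, Real.norm_of_nonneg (hd0 s), mul_assoc (σ s * (1 - σ s))]
      exact mul_le_mul_of_nonneg_left (hL _ (hσ s) x y) (hd0 s))
    (fun s => by simp [h0 _ (hσ s)]) (τ t₀) y₀
  refine ⟨fun t => z (τ t), hz0, fun t ht => ?_⟩
  have h1 := (hz (τ t)).scomp t (hτd t ht)
  refine h1.congr_deriv ?_
  rw [hστ t ht, smul_smul, inv_mul_cancel₀, one_smul]
  exact (mul_pos ht.1 (sub_pos.2 ht.2)).ne'

/-! ### Behaviour of admissible functions at the endpoints -/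

lemma IsACLoc.locallyIntegrableOn_deriv {F : ℝ → ℂ} (hF : IsACLoc F) :
    LocallyIntegrableOn (deriv F) (Ioo 0 1) := by
  intro x hx
  have ha : x / 2 ∈ Ioo (0 : ℝ) 1 := ⟨by linarith [hx.1], by linarith [hx.1, hx.2]⟩
  have hb : (x + 1) / 2 ∈ Ioo (0 : ℝ) 1 := ⟨by linarith [hx.1], by linarith [hx.2]⟩
  have hab : x / 2 ≤ (x + 1) / 2 := by linarith
  have h1 : IntervalIntegrable (deriv fun t => (F t).re) volume (x / 2) ((x + 1) / 2) :=
    (absolutelyContinuousOnInterval_comp_of_lipschitz Complex.reCLM.lipschitz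
      (hF.acOn ha hb)).intervalIntegrable_deriv
  have h2 : IntervalIntegrable (deriv fun t => (F t).im) volume (x / 2) ((x + 1) / 2) :=
    (absolutelyContinuousOnInterval_comp_of_lipschitz Complex.imCLM.lipschitz
      (hF.acOn ha hb)).intervalIntegrable_deriv
  have h3 : IntervalIntegrable (fun t => ((deriv (fun t => (F t).re) t : ℝ) : ℂ)
      + ((deriv (fun t => (F t).im) t : ℝ) : ℂ) * Complex.I) volume (x / 2) ((x + 1) / 2) :=
    IntervalIntegrable.add ⟨h1.1.ofReal, h1.2.ofReal⟩
      (IntervalIntegrable.mul_const ⟨h2.1.ofReal, h2.2.ofReal⟩ _)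
  have h4 : IntervalIntegrable (deriv F) volume (x / 2) ((x + 1) / 2) := by
    refine h3.congr_ae ((ae_restrict_iff' measurableSet_uIoc).2 ?_)
    filter_upwards [hF.ae_differentiableAt] with t ht htx
    have hd := (ht (uIcc_subset_Ioo_zero_one ha hb (uIoc_subset_uIcc htx))).hasDerivAt
    have hre : HasDerivAt (fun t => (F t).re) (deriv F t).re t :=
      Complex.reCLM.hasFDerivAt.comp_hasDerivAt t hd
    have him : HasDerivAt (fun t => (F t).im) (deriv F t).im t :=
      Complex.imCLM.hasFDerivAt.comp_hasDerivAt t hd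
    rw [hre.deriv, him.deriv, Complex.re_add_im]
  rw [intervalIntegrable_iff_integrableOn_Icc_of_le hab] at h4
  exact ⟨_, mem_nhdsWithin_of_mem_nhds (Icc_mem_nhds (by linarith [hx.1]) (by linarith [hx.2])), h4⟩

lemma IsACLoc.ae_hasDerivAt {F : ℝ → ℂ} (hF : IsACLoc F) :
    ∀ᵐ x, x ∈ Ioo (0 : ℝ) 1 → HasDerivAt F (deriv F x) x := by
  filter_upwards [hF.ae_differentiableAt] with x hx hx'
  exact (hx hx').hasDerivAt

lemma hasDerivAt_ofReal_inv {x : ℝ} (hx : x ∈ Ioo (0 : ℝ) 1) :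
    HasDerivAt (fun x : ℝ => (x : ℂ)⁻¹) (-((x : ℂ) ^ 2)⁻¹) x :=
  (hasDerivAt_inv (Complex.ofReal_ne_zero.2 hx.1.ne')).comp_ofReal

lemma continuousOn_ofReal_inv : ContinuousOn (fun x : ℝ => (x : ℂ)⁻¹) (Ioo 0 1) := fun _ hx =>
  (hasDerivAt_ofReal_inv hx).continuousAt.continuousWithinAt

lemma isACLoc_ofReal_inv : IsACLoc fun x : ℝ => (x : ℂ)⁻¹ := by
  refine isACLoc_of_hasDerivAt (fun x hx => hasDerivAt_ofReal_inv hx) ?_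
  exact (continuousOn_ofReal_inv.pow 2).neg.congr fun x _ => by simp

lemma hasDerivAt_of_isACLoc {g : ℝ → ℂ} (hg : IsACLoc g) (hQ : IsACLoc (quasiDeriv g))
    {x : ℝ} (hx : x ∈ Ioo (0 : ℝ) 1) : HasDerivAt g (quasiDeriv g x / (x : ℂ) ^ 2) x := by
  have h := (differentiableAt_of_isACLoc hg hQ hx).hasDerivAt
  have hx0 : (x : ℂ) ≠ 0 := Complex.ofReal_ne_zero.2 hx.1.ne'
  refine h.congr_deriv ?_
  simp only [quasiDeriv, leadCoeff]
  push_cast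
  field_simp

/-- This is the definition of `slExpr` solved for the derivative. It needs no differentiability: the
same default value of `deriv` stands on both sides. -/
lemma deriv_quasiDeriv (f : ℝ → ℝ) (g : ℝ → ℂ) {x : ℝ} (hx : x ∈ Ioo (0 : ℝ) 1) :
    deriv (quasiDeriv g) x = (potential f x : ℂ) * g x - (weight x : ℂ) * slExpr f g x := by
  have : (weight x : ℂ) ≠ 0 := Complex.ofReal_ne_zero.2 (weight_pos hx).ne'
  simp only [slExpr]
  field_simp
  ring

lemma weight_le_two_mul_sq {x : ℝ} (hx : x ∈ Ioc (0 : ℝ) (1 / 2)) : weight x ≤ 2 * x ^ 2 := by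
  have h1 : 3 / 4 ≤ 1 - x ^ 2 := by nlinarith [hx.1, hx.2]
  unfold weight
  rw [div_le_iff₀ (by positivity)]
  have h2 : 1 ≤ 2 * (1 - x ^ 2) ^ 2 := by nlinarith
  nlinarith [mul_le_mul_of_nonneg_left h2 (sq_nonneg x)]

lemma sq_le_weight {x : ℝ} (hx : x ∈ Ioo (0 : ℝ) 1) : x ^ 2 ≤ weight x := by
  have h1 : 0 < 1 - x ^ 2 := by nlinarith [hx.1, hx.2]
  unfold weight
  rw [le_div_iff₀ (by positivity)]
  have h2 : (1 - x ^ 2) ^ 2 ≤ 1 := by nlinarith [sq_nonneg x]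
  nlinarith [mul_le_mul_of_nonneg_left h2 (sq_nonneg x)]

lemma not_integrableOn_inv {x : ℝ} (hx : 0 < x) : ¬ IntegrableOn (fun y : ℝ => y⁻¹) (Ioc 0 x) := by
  intro h
  have h1 : IntervalIntegrable (fun y : ℝ => y⁻¹) volume 0 x :=
    (intervalIntegrable_iff_integrableOn_Ioc_of_le hx.le).2 h
  rcases intervalIntegrable_inv_iff.1 h1 with h2 | h2
  · exact hx.ne h2
  · exact h2 left_mem_uIcc

lemma not_integrableOn_inv_one_sub {p : ℝ} (hp : p < 1) :
    ¬ IntegrableOn (fun y : ℝ => (1 - y)⁻¹) (Ioo p 1) := by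
  intro h
  have h1 : IntervalIntegrable (fun y : ℝ => (y - 1)⁻¹) volume p 1 := by
    rw [intervalIntegrable_iff_integrableOn_Ioo_of_le hp.le]
    refine h.neg.congr_fun (fun y _ => ?_) measurableSet_Ioo
    simp only [Pi.neg_apply, ← inv_neg, neg_sub]
  rcases intervalIntegrable_sub_inv_iff.1 h1 with h2 | h2
  · exact hp.ne h2
  · exact h2 right_mem_uIcc

/-- Near the endpoint `0` an admissible function is bounded and its quasi-derivative vanishes. -/
lemma exists_bound_near_zero {f : ℝ → ℝ} {C δ : ℝ}
    (hq : ∀ x ∈ Ioc (0 : ℝ) δ, |potential f x - 2| ≤ C * x ^ 2) {g : ℝ → ℂ} (hg : IsACLoc g)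
    (hQ : IsACLoc (quasiDeriv g)) (hδ : 0 < δ) (hδ' : δ ≤ 1 / 2)
    (h1 : IntegrableOn (fun x => x * ‖g x‖) (Ioc 0 δ))
    (h2 : IntegrableOn (fun x => x * ‖slExpr f g x‖) (Ioc 0 δ)) :
    ∃ M, ∀ x ∈ Ioc (0 : ℝ) δ, ‖g x‖ ≤ M ∧ ‖quasiDeriv g x‖ ≤ M * x := by
  have hsub : Ioc 0 δ ⊆ Ioo (0 : ℝ) 1 := fun x hx => ⟨hx.1, by linarith [hx.2]⟩
  have hC : 0 ≤ C := by
    have := (abs_nonneg _).trans (hq δ ⟨hδ, le_rfl⟩)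
    exact nonneg_of_mul_nonneg_left this (by positivity)
  set n : ℝ → ℝ := fun x => x * ‖g x‖ + x * ‖slExpr f g x‖ with hn
  have hnI : IntegrableOn n (Ioc 0 δ) := h1.add h2
  have hn0 : ∀ x ∈ Ioc (0 : ℝ) δ, 0 ≤ n x := fun x hx => by
    have := hx.1.le
    positivity
  -- `S = g' + 2g/x`. Its derivative is `((q - 2) g - w · a g) / x²`, with no term in `g'`; the
  -- assumption on `q` and `w ≤ 2x²` bound it by a multiple of `n x / x` with `n` integrable.
  set S : ℝ → ℂ := fun x => quasiDeriv g x * ((x : ℂ)⁻¹ * (x : ℂ)⁻¹) + 2 * (x : ℂ)⁻¹ * g x with hS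
  have hcAC : IsACLoc fun _ => (2 : ℂ) := isACLoc_of_contDiffOn contDiffOn_const
  have hSAC : IsACLoc S := (hQ.mul (isACLoc_ofReal_inv.mul isACLoc_ofReal_inv)).add
    ((hcAC.mul isACLoc_ofReal_inv).mul hg)
  have hSd : ∀ᵐ x, x ∈ Ioc (0 : ℝ) δ → ‖deriv S x‖ ≤ (C + 2) * n x / x := by
    filter_upwards [hQ.ae_differentiableAt] with x hx hxδ
    have hx1 := hsub hxδ
    have hx0 : (x : ℂ) ≠ 0 := Complex.ofReal_ne_zero.2 hx1.1.ne'
    have hxp := hxδ.1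
    have e1 := ((hx hx1).hasDerivAt.mul
      ((hasDerivAt_ofReal_inv hx1).mul (hasDerivAt_ofReal_inv hx1))).add
      (((hasDerivAt_ofReal_inv hx1).const_mul 2).mul (hasDerivAt_of_isACLoc hg hQ hx1))
    have e2 : deriv S x = (((potential f x - 2 : ℝ) : ℂ) * g x - (weight x : ℂ) * slExpr f g x)
        / (x : ℂ) ^ 2 := by
      refine e1.deriv.trans ?_
      rw [deriv_quasiDeriv f g hx1, Pi.mul_apply]
      push_cast
      field_simp
      ring
    have hw0 := (weight_pos hx1).le
    have hw := weight_le_two_mul_sq (x := x) ⟨hxδ.1, hxδ.2.trans hδ'⟩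
    rw [e2, norm_div, norm_pow, Complex.norm_real, Real.norm_of_nonneg hxp.le,
      div_le_div_iff₀ (by positivity) hxp]
    have b1 : ‖((potential f x - 2 : ℝ) : ℂ) * g x‖ ≤ C * x ^ 2 * ‖g x‖ := by
      rw [norm_mul, Complex.norm_real]
      exact mul_le_mul_of_nonneg_right (hq x hxδ) (norm_nonneg _)
    have b2 : ‖(weight x : ℂ) * slExpr f g x‖ ≤ 2 * x ^ 2 * ‖slExpr f g x‖ := by
      rw [norm_mul, Complex.norm_real, Real.norm_of_nonneg hw0]
      exact mul_le_mul_of_nonneg_right hw (norm_nonneg _)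
    have b3 := (norm_sub_le _ _).trans (add_le_add b1 b2)
    calc _ ≤ (C * x ^ 2 * ‖g x‖ + 2 * x ^ 2 * ‖slExpr f g x‖) * x :=
          mul_le_mul_of_nonneg_right b3 hxp.le
      _ ≤ ((C + 2) * x ^ 2 * ‖g x‖ + (C + 2) * x ^ 2 * ‖slExpr f g x‖) * x := by
          gcongr <;> linarith
      _ = _ := by
          simp only [hn]
          ring
  set M₀ : ℝ := ∫ x in Ioc 0 δ, n x with hM₀
  have hM₀0 : 0 ≤ M₀ := setIntegral_nonneg measurableSet_Ioc hn0
  set M : ℝ := ‖S δ‖ + (C + 2) * M₀ with hM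
  have hM0 : 0 ≤ M := by positivity
  -- Integration of `S'` from `x` to `δ`, with `1/t` estimated by `1/x`.
  have hSb : ∀ x ∈ Ioc (0 : ℝ) δ, ‖S x‖ ≤ M / x := by
    intro x hx
    have hxp := hx.1
    have e1 := hSAC.integral_eq_sub hSAC.ae_hasDerivAt hSAC.locallyIntegrableOn_deriv (hsub hx)
      (hsub ⟨hδ, le_rfl⟩)
    have hnx : IntegrableOn n (Ioc x δ) := hnI.mono_set (Ioc_subset_Ioc_left hx.1.le)
    have e2 : ‖∫ t in x..δ, deriv S t‖ ≤ ∫ t in x..δ, (C + 2) / x * n t := by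
      refine intervalIntegral.norm_integral_le_of_norm_le hx.2 ?_
        ((intervalIntegrable_iff_integrableOn_Ioc_of_le hx.2).2 (hnx.const_mul _))
      filter_upwards [hSd] with t ht htx
      have htp : 0 < t := hxp.trans htx.1
      have ht' : t ∈ Ioc 0 δ := ⟨htp, htx.2⟩
      refine (ht ht').trans ?_
      rw [div_mul_eq_mul_div]
      have := hn0 t ht'
      gcongr
      exact htx.1.le
    have e3 : ∫ t in x..δ, (C + 2) / x * n t ≤ (C + 2) / x * M₀ := by
      rw [intervalIntegral.integral_const_mul, intervalIntegral.integral_of_le hx.2]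
      refine mul_le_mul_of_nonneg_left ?_ (by positivity)
      exact setIntegral_mono_set hnI ((ae_restrict_iff' measurableSet_Ioc).2
        (Eventually.of_forall hn0)) (Ioc_subset_Ioc_left hx.1.le).eventuallyLE
    have e4 : ‖S x‖ ≤ ‖S δ‖ + ‖∫ t in x..δ, deriv S t‖ := by
      have : S x = S δ - ∫ t in x..δ, deriv S t := by rw [e1]; ring
      rw [this]
      exact norm_sub_le _ _
    rw [le_div_iff₀ hxp]
    have e5 : ‖S x‖ ≤ ‖S δ‖ + (C + 2) / x * M₀ := by linarith
    calc ‖S x‖ * x ≤ (‖S δ‖ + (C + 2) / x * M₀) * x := mul_le_mul_of_nonneg_right e5 hxp.le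
      _ = ‖S δ‖ * x + (C + 2) * M₀ := by field_simp
      _ ≤ ‖S δ‖ * 1 + (C + 2) * M₀ := by
          gcongr
          linarith [hx.2]
      _ = M := by rw [hM, mul_one]
  have hUd : ∀ x ∈ Ioo (0 : ℝ) 1,
      HasDerivAt (fun x : ℝ => (x : ℂ) ^ 2 * g x) ((x : ℂ) ^ 2 * S x) x := by
    intro x hx
    have hx0 : (x : ℂ) ≠ 0 := Complex.ofReal_ne_zero.2 hx.1.ne'
    have e1 : HasDerivAt (fun x : ℝ => (x : ℂ) ^ 2) (2 * (x : ℂ)) x := by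
      simpa using (hasDerivAt_pow 2 (x : ℂ)).comp_ofReal
    refine (e1.mul (hasDerivAt_of_isACLoc hg hQ hx)).congr_deriv ?_
    simp only [hS]
    field_simp
    ring
  have hUS : ∀ t ∈ Ioc (0 : ℝ) δ, ‖(t : ℂ) ^ 2 * S t‖ ≤ M * t := by
    intro t ht
    have htp := ht.1
    rw [norm_mul, norm_pow, Complex.norm_real, Real.norm_of_nonneg htp.le]
    calc t ^ 2 * ‖S t‖ ≤ t ^ 2 * (M / t) := mul_le_mul_of_nonneg_left (hSb t ht) (by positivity)
      _ = M * t := by field_simp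
  have hUb : ∀ x ∈ Ioc (0 : ℝ) δ, ‖(x : ℂ) ^ 2 * g x‖ ≤ M * x ^ 2 := by
    intro x hx
    have hxp := hx.1
    refine le_of_forall_pos_le_add fun ε hε => ?_
    -- If `‖y² g y‖ ≥ ε` on all of `(0, x]`, then `y ‖g y‖ ≥ ε / y` would not be integrable. So `y²
    -- g` is small at some `y`, and the mean value inequality carries the bound from `y` to `x`.
    obtain ⟨y, hy, hyε⟩ : ∃ y ∈ Ioc (0 : ℝ) x, ‖(y : ℂ) ^ 2 * g y‖ < ε := by
      by_contra! hcon
      refine not_integrableOn_inv hxp ?_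
      have h3 : IntegrableOn (fun y => ε⁻¹ * (y * ‖g y‖)) (Ioc 0 x) :=
        (h1.mono_set (Ioc_subset_Ioc_right hx.2)).const_mul _
      refine Integrable.mono' h3 (by fun_prop) ((ae_restrict_iff' measurableSet_Ioc).2
        (Eventually.of_forall fun y hy => ?_))
      have hyp := hy.1
      have := hcon y hy
      rw [norm_mul, norm_pow, Complex.norm_real, Real.norm_of_nonneg hyp.le] at this
      rw [norm_inv, Real.norm_of_nonneg hyp.le, inv_mul_eq_div, le_div_iff₀ hε, inv_mul_le_iff₀ hyp]
      calc ε ≤ _ := this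
        _ = _ := by ring
    have hsub' : Icc y x ⊆ Ioc 0 δ := fun t ht => ⟨hy.1.trans_le ht.1, ht.2.trans hx.2⟩
    have h4 := (convex_Icc y x).norm_image_sub_le_of_norm_hasDerivWithin_le
      (f := fun x : ℝ => (x : ℂ) ^ 2 * g x) (f' := fun x : ℝ => (x : ℂ) ^ 2 * S x) (C := M * x)
      (fun t ht => (hUd t (hsub (hsub' ht))).hasDerivWithinAt)
      (fun t ht => (hUS t (hsub' ht)).trans (mul_le_mul_of_nonneg_left ht.2 hM0))
      (left_mem_Icc.2 hy.2) (right_mem_Icc.2 hy.2)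
    have h5 : M * x * ‖x - y‖ ≤ M * x ^ 2 := by
      rw [Real.norm_of_nonneg (sub_nonneg.2 hy.2), pow_two, ← mul_assoc]
      exact mul_le_mul_of_nonneg_left (by linarith [hy.1]) (by positivity)
    have h6 := norm_sub_norm_le ((x : ℂ) ^ 2 * g x) ((y : ℂ) ^ 2 * g y)
    linarith
  -- In `p g' = x² S - 2x g` the first term contributes `M x` and the second `2M x`.
  refine ⟨3 * M, fun x hx => ?_⟩
  have hxp := hx.1
  have h3 := hUb x hx
  rw [norm_mul, norm_pow, Complex.norm_real, Real.norm_of_nonneg hxp.le, mul_comm] at h3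
  have hgM : ‖g x‖ ≤ M := le_of_mul_le_mul_right h3 (by positivity)
  refine ⟨by linarith, ?_⟩
  have hx0 : (x : ℂ) ≠ 0 := Complex.ofReal_ne_zero.2 hxp.ne'
  have h4 : quasiDeriv g x = (x : ℂ) ^ 2 * S x - 2 * x * g x := by
    simp only [hS]
    field_simp
    ring
  have h5 : ‖2 * (x : ℂ) * g x‖ ≤ 2 * x * M := by
    rw [norm_mul, norm_mul, Complex.norm_real, Real.norm_of_nonneg hxp.le, Complex.norm_ofNat]
    exact mul_le_mul_of_nonneg_left hgM (by positivity)
  rw [h4]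
  have := norm_sub_le ((x : ℂ) ^ 2 * S x) (2 * x * g x)
  have := hUS x hx
  linarith

/-! ### Energy estimate near the endpoint `1`. -/

lemma abs_potential_le (f : ℝ → ℝ) {x : ℝ} (hx : x ∈ Ioo (0 : ℝ) 1) :
    |potential f x| ≤ 2 / (1 - x) ^ 2 := by
  have h1 : 0 < 1 - x := sub_pos.2 hx.2
  have h0 := hx.1
  have h2 : 1 - x ≤ 1 - x ^ 2 := by nlinarith
  have h3 : 0 < 1 - x ^ 2 := by linarith
  unfold potential
  rw [abs_div, abs_of_nonneg (a := (1 - x ^ 2) ^ 2) (sq_nonneg _)]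
  refine div_le_div₀ (by norm_num) ?_ (by positivity) (by gcongr)
  have h4 := Real.neg_one_le_cos (2 * f x)
  have h5 := Real.cos_le_one (2 * f x)
  rw [abs_le]
  constructor <;> nlinarith

lemma weight_le {x : ℝ} (hx : x ∈ Ioo (0 : ℝ) 1) : weight x ≤ 1 / (1 - x) ^ 2 := by
  have h1 : 0 < 1 - x := sub_pos.2 hx.2
  have h0 := hx.1
  have h2 : 1 - x ≤ 1 - x ^ 2 := by nlinarith
  unfold weight
  exact div_le_div₀ (by norm_num) (by nlinarith) (by positivity) (by gcongr)

/-- Near the endpoint `1` the quasi-derivative of an admissible function is square integrable. -/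
lemma integrableOn_quasiDeriv_near_one {f : ℝ → ℝ} {c : ℝ} (hc : c ∈ Ioo (0 : ℝ) 1) {g : ℝ → ℂ}
    (hg : IsACLoc g) (hQ : IsACLoc (quasiDeriv g))
    (h1 : IntegrableOn (fun x => ‖g x‖ ^ 2 / (1 - x) ^ 2) (Ioo c 1))
    (h2 : IntegrableOn (fun x => ‖slExpr f g x‖ ^ 2 / (1 - x) ^ 2) (Ioo c 1)) :
    IntegrableOn (fun x => ‖quasiDeriv g x‖ ^ 2) (Ioo c 1) := by
  have hsub : Ioo c 1 ⊆ Ioo (0 : ℝ) 1 := Ioo_subset_Ioo_left hc.1.le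
  -- `R' = ‖p g'‖²/x² + k` almost everywhere. Since `q` and `w` are `O((1-x)⁻²)`, the term `k` is
  -- integrable up to `1`, so the integral of the energy `e = ‖p g'‖²/x²` is controlled by `Re R`.
  set R : ℝ → ℂ := fun x => star (g x) * quasiDeriv g x with hR
  have hRAC : IsACLoc R := hg.conj.mul hQ
  set k : ℝ → ℂ := fun x => star (g x) * deriv (quasiDeriv g) x with hk
  have hkI : IntegrableOn k (Ioo c 1) := by
    refine Integrable.mono' ((h1.const_mul 3).add h2) ?_ ((ae_restrict_iff' measurableSet_Ioo).2
      (Eventually.of_forall fun x hx => ?_))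
    · exact ((hg.conj.continuousOn.mono hsub).aestronglyMeasurable measurableSet_Ioo).mul
        (aestronglyMeasurable_deriv _ _)
    · have hx1 := hsub hx
      have hpos : 0 < 1 - x := sub_pos.2 hx1.2
      simp only [hk, Pi.add_apply, norm_mul, norm_star]
      rw [deriv_quasiDeriv f g hx1]
      have b1 : ‖(potential f x : ℂ) * g x‖ ≤ 2 / (1 - x) ^ 2 * ‖g x‖ := by
        rw [norm_mul, Complex.norm_real]
        exact mul_le_mul_of_nonneg_right (abs_potential_le f hx1) (norm_nonneg _)
      have b2 : ‖(weight x : ℂ) * slExpr f g x‖ ≤ 1 / (1 - x) ^ 2 * ‖slExpr f g x‖ := by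
        rw [norm_mul, Complex.norm_real, Real.norm_of_nonneg (weight_pos hx1).le]
        exact mul_le_mul_of_nonneg_right (weight_le hx1) (norm_nonneg _)
      have b3 := (norm_sub_le _ _).trans (add_le_add b1 b2)
      calc _ ≤ ‖g x‖ * (2 / (1 - x) ^ 2 * ‖g x‖ + 1 / (1 - x) ^ 2 * ‖slExpr f g x‖) :=
            mul_le_mul_of_nonneg_left b3 (norm_nonneg _)
        _ = (2 * ‖g x‖ ^ 2 + ‖g x‖ * ‖slExpr f g x‖) / (1 - x) ^ 2 := by ring
        _ ≤ (3 * ‖g x‖ ^ 2 + ‖slExpr f g x‖ ^ 2) / (1 - x) ^ 2 := by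
            refine div_le_div_of_nonneg_right ?_ (by positivity)
            nlinarith [sq_nonneg (‖g x‖ - ‖slExpr f g x‖), sq_nonneg (‖slExpr f g x‖),
              sq_nonneg (‖g x‖)]
        _ = _ := by ring
  set e : ℝ → ℝ := fun x => ‖quasiDeriv g x‖ ^ 2 / x ^ 2 with he
  have heC : ContinuousOn e (Ioo 0 1) := by
    refine ContinuousOn.div (hQ.continuousOn.norm.pow 2) (by fun_prop) fun x hx => ?_
    exact pow_ne_zero 2 hx.1.ne'
  have hgd : ∀ x ∈ Ioo (0 : ℝ) 1, star (quasiDeriv g x / (x : ℂ) ^ 2) * quasiDeriv g x = e x := by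
    intro x hx
    have := Complex.conj_mul' (quasiDeriv g x)
    simp only [he, star_div₀, star_pow, RCLike.star_def, Complex.conj_ofReal]
    rw [div_mul_eq_mul_div, this]
    push_cast
    rfl
  have hRd : ∀ᵐ x, x ∈ Ioo (0 : ℝ) 1 → HasDerivAt R ((e x : ℂ) + k x) x := by
    filter_upwards [hQ.ae_hasDerivAt] with x hx hx1
    have := (hasDerivAt_of_isACLoc hg hQ hx1).star.mul (hx hx1)
    rwa [hgd x hx1] at this
  have heI : LocallyIntegrableOn (fun x => (e x : ℂ)) (Ioo 0 1) :=
    (Complex.continuous_ofReal.comp_continuousOn heC).locallyIntegrableOn measurableSet_Ioo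
  have hkL : LocallyIntegrableOn k (Ioo 0 1) := by
    have := locallyIntegrableOn_mul_continuousOn hQ.locallyIntegrableOn_deriv hg.conj.continuousOn
    simpa only [hk, mul_comm] using this
  set M : ℝ := ‖R c‖ + ∫ x in Ioo c 1, ‖k x‖ with hM
  have hbound : ∀ x ∈ Ioo c 1, (∫ t in c..x, e t) ≤ (R x).re + M := by
    intro x hx
    have e1 := hRAC.integral_eq_sub hRd (heI.add hkL) hc (hsub hx)
    rw [intervalIntegral.integral_add (intervalIntegrable_of_locallyIntegrableOn heI hc (hsub hx))
      (intervalIntegrable_of_locallyIntegrableOn hkL hc (hsub hx)),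
      intervalIntegral.integral_ofReal] at e1
    have e2 := congrArg Complex.re e1
    simp only [Complex.add_re, Complex.ofReal_re, Complex.sub_re] at e2
    have e3 : ‖∫ t in c..x, k t‖ ≤ ∫ t in Ioo c 1, ‖k t‖ := by
      refine (intervalIntegral.norm_integral_le_integral_norm hx.1.le).trans ?_
      rw [intervalIntegral.integral_of_le hx.1.le]
      exact setIntegral_mono_set hkI.norm (Eventually.of_forall fun t => norm_nonneg _)
        (Ioc_subset_Ioo_right hx.2).eventuallyLE
    have e4 := (Complex.abs_re_le_norm (∫ t in c..x, k t))
    have e5 := (Complex.abs_re_le_norm (R c))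
    have e6 := neg_abs_le (∫ t in c..x, k t).re
    have e7 := neg_abs_le (R c).re
    linarith
  -- The derivative of `‖g‖²` is `2 Re R / x²`. If `Re R > 1` held near `1`, then `‖g‖²` would
  -- increase and stay above a positive constant, contradicting the integrability of `‖g‖²/(1-x)²`.
  -- Since `e ≥ 0`, bounding its integrals along a sequence with `Re R ≤ 1` is enough.
  have hfreq : ∃ᶠ x in 𝓝[<] (1 : ℝ), x ∈ Ioo c 1 ∧ (R x).re ≤ 1 := by
    intro hev
    have hev' : ∀ᶠ x in 𝓝[<] (1 : ℝ), 1 < (R x).re := by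
      filter_upwards [hev, Ioo_mem_nhdsLT hc.2] with x hx hx'
      by_contra h
      exact hx ⟨hx', not_lt.1 h⟩
    obtain ⟨a, ha, hra⟩ := (mem_nhdsLT_iff_exists_Ioo_subset' hc.2).1 hev'
    obtain ⟨a', ha', ha'1⟩ := exists_between (max_lt ha hc.2)
    obtain ⟨p, hp, hp1⟩ := exists_between ha'1
    have hca' : c < a' := (le_max_right _ _).trans_lt ha'
    have haa' : a < a' := (le_max_left _ _).trans_lt ha'
    have hFd : ∀ x ∈ Ioo (0 : ℝ) 1, HasDerivAt (fun x => ‖g x‖ ^ 2) (2 * ((R x).re / x ^ 2)) x := by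
      intro x hx
      have h3 := (hasDerivAt_of_isACLoc hg hQ hx).norm_sq
      refine h3.congr_deriv ?_
      rw [Complex.inner]
      congr 1
      have : quasiDeriv g x / (x : ℂ) ^ 2 * (starRingEnd ℂ) (g x) = R x / ((x ^ 2 : ℝ) : ℂ) := by
        simp only [hR, RCLike.star_def]
        push_cast
        ring
      rw [this, Complex.div_ofReal_re]
    have hmono : StrictMonoOn (fun x => ‖g x‖ ^ 2) (Ico a' 1) := by
      have hs : Ico a' 1 ⊆ Ioo (0 : ℝ) 1 := fun x hx => ⟨by linarith [hx.1, hc.1], hx.2⟩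
      refine strictMonoOn_of_deriv_pos (convex_Ico _ _)
        (fun x hx => (hFd x (hs hx)).continuousAt.continuousWithinAt) fun x hx => ?_
      rw [interior_Ico] at hx
      have hx' := hs ⟨hx.1.le, hx.2⟩
      rw [(hFd x hx').deriv]
      have h4 : 1 < (R x).re := hra ⟨haa'.trans hx.1, hx.2⟩
      have := hx'.1
      positivity
    have hFp : 0 < ‖g p‖ ^ 2 :=
      (sq_nonneg _).trans_lt (hmono ⟨le_rfl, ha'1⟩ ⟨hp.le, hp1⟩ hp)
    refine not_integrableOn_inv_one_sub hp1 ?_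
    have h3 : IntegrableOn (fun y => (‖g p‖ ^ 2)⁻¹ * (‖g y‖ ^ 2 / (1 - y) ^ 2)) (Ioo p 1) :=
      (h1.mono_set (Ioo_subset_Ioo_left (hca'.trans hp).le)).const_mul _
    refine Integrable.mono' h3 (by fun_prop) ((ae_restrict_iff' measurableSet_Ioo).2
      (Eventually.of_forall fun y hy => ?_))
    have hpos : 0 < 1 - y := sub_pos.2 hy.2
    have hle : ‖g p‖ ^ 2 ≤ ‖g y‖ ^ 2 :=
      hmono.monotoneOn ⟨hp.le, hp1⟩ ⟨(hp.trans hy.1).le, hy.2⟩ hy.1.le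
    have h01 : 1 - y ≤ 1 := by linarith [hc.1, hca', hp, hy.1]
    rw [norm_inv, Real.norm_of_nonneg hpos.le, ← mul_div_assoc, le_div_iff₀ (by positivity)]
    calc (1 - y)⁻¹ * (1 - y) ^ 2 = 1 - y := by field_simp
      _ ≤ 1 := h01
      _ ≤ (‖g p‖ ^ 2)⁻¹ * ‖g y‖ ^ 2 := by rwa [inv_mul_eq_div, one_le_div hFp]
  obtain ⟨u, hu, hu'⟩ := exists_seq_forall_of_frequently hfreq
  have heI' : IntegrableOn e (Ioc c 1) := by
    refine integrableOn_Ioc_of_intervalIntegral_norm_bounded_right (l := atTop) (b := u)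
      (I := 1 + M) (fun i => ?_) (hu.mono_right nhdsWithin_le_nhds)
      (Eventually.of_forall fun i => ?_)
    · refine (heC.mono ?_).integrableOn_Icc.mono_set Ioc_subset_Icc_self
      exact Icc_subset_Ioo_zero_one hc.1 (hu' i).1.2
    · have h3 := hbound (u i) (hu' i).1
      rw [intervalIntegral.integral_of_le (hu' i).1.1.le] at h3
      have h4 : ∀ x, ‖e x‖ = e x := fun x => Real.norm_of_nonneg (by positivity)
      simp only [h4]
      linarith [(hu' i).2]
  refine Integrable.mono' (heI'.mono_set Ioo_subset_Ioc_self) ?_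
    ((ae_restrict_iff' measurableSet_Ioo).2 (Eventually.of_forall fun x hx => ?_))
  · exact (((hQ.continuousOn.mono hsub).norm.pow 2).aestronglyMeasurable measurableSet_Ioo)
  · rw [Real.norm_of_nonneg (by positivity)]
    have hx1 := hsub hx
    have := hx1.1
    rw [he, le_div_iff₀ (by positivity)]
    exact mul_le_of_le_one_right (by positivity) (pow_le_one₀ hx1.1.le hx1.2.le)

/-- `g` and its quasi-derivative are locally absolutely continuous, and `g` and `a g` are square
integrable with weight `w` near the endpoint `e`. -/
structure IsLocalDomainRep (f : ℝ → ℝ) (e : ℝ) (g : ℝ → ℂ) : Prop where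
  ac : IsACLoc g
  ac_quasiDeriv : IsACLoc (quasiDeriv g)
  integrable : IntegrableAtFilter (fun x => ‖g x‖ ^ 2) (𝓝[Ioo 0 1] e) weightMeasure
  integrable_slExpr :
    IntegrableAtFilter (fun x => ‖slExpr f g x‖ ^ 2) (𝓝[Ioo 0 1] e) weightMeasure

/-! ### From the weighted measure to Lebesgue estimates near the endpoints. -/

lemma integrableOn_weightMeasure_iff {F : ℝ → ℝ} {s : Set ℝ} (hs : MeasurableSet s)
    (hs' : s ⊆ Ioo 0 1) :
    IntegrableOn F s weightMeasure ↔ IntegrableOn (fun x => weight x * F x) s := by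
  unfold IntegrableOn weightMeasure
  rw [restrict_withDensity hs, Measure.restrict_restrict hs, inter_eq_left.2 hs',
    integrable_withDensity_iff_integrable_smul' measurable_weight.ennreal_ofReal
      (Eventually.of_forall fun _ => ENNReal.ofReal_lt_top)]
  refine integrable_congr ((ae_restrict_iff' hs).2 (Eventually.of_forall fun x hx => ?_))
  simp only [smul_eq_mul]
  rw [ENNReal.toReal_ofReal (weight_pos (hs' hx)).le]

lemma IsProfile.continuousOn {n : ℕ} {f : ℝ → ℝ} (hf : IsProfile n f) :
    ContinuousOn f (Ioo 0 1) := hf.analytic.continuousOn.mono Ioo_subset_Icc_self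

lemma one_sub_sq_pos {x : ℝ} (hx : x ∈ Ioo (0 : ℝ) 1) : 0 < 1 - x ^ 2 := by
  nlinarith [hx.1, hx.2]

lemma continuousOn_potential {f : ℝ → ℝ} (hf : ContinuousOn f (Ioo 0 1)) :
    ContinuousOn (potential f) (Ioo 0 1) := by
  unfold potential
  refine ContinuousOn.div (ContinuousOn.sub (ContinuousOn.mul (by fun_prop)
    (Real.continuous_cos.comp_continuousOn (continuousOn_const.mul hf))) (by fun_prop))
    (by fun_prop) fun x hx => ?_
  exact pow_ne_zero 2 (one_sub_sq_pos hx).ne'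

lemma continuousOn_weight : ContinuousOn weight (Ioo 0 1) := by
  unfold weight
  refine ContinuousOn.div (by fun_prop) (by fun_prop) fun x hx => ?_
  exact pow_ne_zero 2 (one_sub_sq_pos hx).ne'

lemma IsACLoc.aestronglyMeasurable {g : ℝ → ℂ} (hg : IsACLoc g) :
    AEStronglyMeasurable g (volume.restrict (Ioo 0 1)) :=
  hg.continuousOn.aestronglyMeasurable measurableSet_Ioo

lemma aestronglyMeasurable_slExpr {f : ℝ → ℝ} (hf : ContinuousOn f (Ioo 0 1)) {g : ℝ → ℂ}
    (hg : IsACLoc g) : AEStronglyMeasurable (slExpr f g) (volume.restrict (Ioo 0 1)) := by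
  have h1 : AEStronglyMeasurable (fun x => (weight x : ℂ)⁻¹) (volume.restrict (Ioo 0 1)) :=
    (Complex.measurable_ofReal.comp measurable_weight).inv.aestronglyMeasurable
  have h2 : AEStronglyMeasurable (fun x => (potential f x : ℂ)) (volume.restrict (Ioo 0 1)) :=
    (Complex.continuous_ofReal.comp_continuousOn
      (continuousOn_potential hf)).aestronglyMeasurable measurableSet_Ioo
  exact h1.mul ((aestronglyMeasurable_deriv _ _).neg.add (h2.mul hg.aestronglyMeasurable))

/-- Differentiability at `0` and `f 0 = 0` give `|f x| ≤ K x`, and `cos 2f = 1 - 2 sin² f` makes the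
deviation quadratic. The numerator of `q - 2` is at most `(4K² + 1) x²`; the denominator is at least
`1/2`, which doubles the constant. -/
lemma IsProfile.exists_abs_potential_sub_two_le {n : ℕ} {f : ℝ → ℝ} (hf : IsProfile n f) :
    ∃ C, ∃ δ > 0, δ ≤ 1 / 2 ∧ ∀ x ∈ Ioc (0 : ℝ) δ, |potential f x - 2| ≤ C * x ^ 2 := by
  have hd : DifferentiableWithinAt ℝ f (Icc 0 1) 0 :=
    (hf.analytic 0 (by simp)).differentiableWithinAt.mono (subset_insert _ _)
  obtain ⟨K, hK⟩ := hd.isBigO_sub.bound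
  have hK' : ∀ᶠ x in 𝓝[>] (0 : ℝ), |f x| ≤ K * x := by
    have h1 : 𝓝[>] (0 : ℝ) ≤ 𝓝[Icc 0 1] 0 := by
      rw [← nhdsWithin_Ioo_eq_nhdsGT (zero_lt_one' ℝ)]
      exact nhdsWithin_mono _ Ioo_subset_Icc_self
    filter_upwards [h1 hK, self_mem_nhdsWithin] with x hx hx0
    have hx0' : 0 < x := hx0
    simpa [hf.at_zero, abs_of_pos hx0'] using hx
  obtain ⟨δ, hδ, hδK⟩ := mem_nhdsGT_iff_exists_Ioc_subset.1 hK'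
  have hδ0 : (0 : ℝ) < δ := hδ
  refine ⟨8 * K ^ 2 + 2, min δ (1 / 2), by positivity, min_le_right _ _, fun x hx => ?_⟩
  have hx0 := hx.1
  have hx2 : x ≤ 1 / 2 := hx.2.trans (min_le_right _ _)
  have hfx : |f x| ≤ K * x := hδK ⟨hx.1, hx.2.trans (min_le_left _ _)⟩
  have hs : Real.cos (2 * f x) - 1 = -(2 * Real.sin (f x) ^ 2) := by
    rw [Real.cos_two_mul, Real.cos_sq']
    ring
  have hs' : Real.sin (f x) ^ 2 ≤ (K * x) ^ 2 := by
    rw [← sq_abs]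
    gcongr
    exact Real.abs_sin_le_abs.trans hfx
  have h0 : 0 ≤ Real.sin (f x) ^ 2 := sq_nonneg _
  have hD : 3 / 4 ≤ 1 - x ^ 2 := by nlinarith
  have hD1 : 1 - x ^ 2 ≤ 1 := by nlinarith
  have he : potential f x - 2 = (-(4 * (1 - x ^ 2) * Real.sin (f x) ^ 2) + x ^ 2 * (1 - 2 * x ^ 2))
      / (1 - x ^ 2) ^ 2 := by
    have hc : Real.cos (2 * f x) = 1 - 2 * Real.sin (f x) ^ 2 := by linarith
    have hD0 : 1 - x ^ 2 ≠ 0 := by linarith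
    unfold potential
    rw [hc]
    field_simp
    ring
  have hD2 : 1 / 2 ≤ (1 - x ^ 2) ^ 2 := by nlinarith
  rw [he, abs_div, abs_of_nonneg (a := (1 - x ^ 2) ^ 2) (sq_nonneg _),
    div_le_iff₀ (by positivity)]
  have h1 : |-(4 * (1 - x ^ 2) * Real.sin (f x) ^ 2) + x ^ 2 * (1 - 2 * x ^ 2)|
      ≤ (4 * K ^ 2 + 1) * x ^ 2 := by
    have b1 : (1 - x ^ 2) * Real.sin (f x) ^ 2 ≤ K ^ 2 * x ^ 2 := by nlinarith
    have b2 : 0 ≤ (1 - x ^ 2) * Real.sin (f x) ^ 2 := mul_nonneg (by linarith) h0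
    have b3 : x ^ 2 * (1 - 2 * x ^ 2) ≤ x ^ 2 := by nlinarith [sq_nonneg (x ^ 2)]
    have b4 : 0 ≤ x ^ 2 * (1 - 2 * x ^ 2) := mul_nonneg (sq_nonneg _) (by nlinarith)
    rw [abs_le]
    constructor <;> nlinarith [sq_nonneg x]
  calc _ ≤ (4 * K ^ 2 + 1) * x ^ 2 := h1
    _ = (8 * K ^ 2 + 2) * x ^ 2 * (1 / 2) := by ring
    _ ≤ _ := by gcongr

/-- `x ‖h‖ ≤ 1 + x² ‖h‖²` and `x² ≤ w`. -/
lemma integrableOn_mul_norm {h : ℝ → ℂ} {δ : ℝ} (hδ' : δ ≤ 1 / 2)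
    (hm : AEStronglyMeasurable h (volume.restrict (Ioo 0 1)))
    (hI : IntegrableOn (fun x => ‖h x‖ ^ 2) (Ioc 0 δ) weightMeasure) :
    IntegrableOn (fun x => x * ‖h x‖) (Ioc 0 δ) := by
  have hsub : Ioc 0 δ ⊆ Ioo (0 : ℝ) 1 := fun x hx => ⟨hx.1, by linarith [hx.2]⟩
  rw [integrableOn_weightMeasure_iff measurableSet_Ioc hsub] at hI
  refine Integrable.mono' ((integrableOn_const (C := (1 : ℝ)) (by simp)).add hI) ?_
    ((ae_restrict_iff' measurableSet_Ioc).2 (Eventually.of_forall fun x hx => ?_))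
  · exact (measurable_id.aestronglyMeasurable).mul
      ((hm.mono_measure (Measure.restrict_mono hsub le_rfl)).norm)
  · have hx0 := hx.1
    rw [Real.norm_of_nonneg (by positivity), Pi.add_apply]
    have := mul_le_mul_of_nonneg_right (sq_le_weight (hsub hx)) (sq_nonneg ‖h x‖)
    nlinarith [sq_nonneg (x * ‖h x‖ - 1)]

lemma IsLocalDomainRep.near_zero {n : ℕ} {f : ℝ → ℝ} (hf : IsProfile n f) {g : ℝ → ℂ}
    (hg : IsLocalDomainRep f 0 g) :
    ∃ M, ∀ᶠ x in 𝓝[>] (0 : ℝ), ‖g x‖ ≤ M ∧ ‖quasiDeriv g x‖ ≤ M * x := by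
  obtain ⟨C, δ₀, hδ₀, hδ₀', hC⟩ := hf.exists_abs_potential_sub_two_le
  obtain ⟨s, hs, hsI⟩ := hg.integrable
  obtain ⟨t, ht, htI⟩ := hg.integrable_slExpr
  have hst := inter_mem hs ht
  rw [nhdsWithin_Ioo_eq_nhdsGT (zero_lt_one' ℝ)] at hst
  obtain ⟨δ₁, hδ₁, hsub⟩ := mem_nhdsGT_iff_exists_Ioc_subset.1 hst
  have hδ : 0 < min δ₀ δ₁ := lt_min hδ₀ hδ₁
  have hδ' : min δ₀ δ₁ ≤ 1 / 2 := (min_le_left _ _).trans hδ₀'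
  have hsub' : Ioc 0 (min δ₀ δ₁) ⊆ s ∩ t := (Ioc_subset_Ioc_right (min_le_right _ _)).trans hsub
  obtain ⟨M, hM⟩ := exists_bound_near_zero
    (fun x hx => hC x ⟨hx.1, hx.2.trans (min_le_left _ _)⟩) hg.ac hg.ac_quasiDeriv hδ hδ'
    (integrableOn_mul_norm hδ' hg.ac.aestronglyMeasurable
      (hsI.mono_set (hsub'.trans inter_subset_left)))
    (integrableOn_mul_norm hδ' (aestronglyMeasurable_slExpr hf.continuousOn hg.ac)
      (htI.mono_set (hsub'.trans inter_subset_right)))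
  exact ⟨M, by filter_upwards [Ioc_mem_nhdsGT hδ] with x hx using hM x hx⟩

/-- For `1/2 ≤ x < 1` one has `(1 + x)² ≤ 4 ≤ 16 x²`, hence `(1 - x)⁻² ≤ 16 w`. -/
lemma integrableOn_sq_div {h : ℝ → ℂ} {c : ℝ} (hc : 1 / 2 ≤ c)
    (hm : AEStronglyMeasurable h (volume.restrict (Ioo 0 1)))
    (hI : IntegrableOn (fun x => ‖h x‖ ^ 2) (Ioo c 1) weightMeasure) :
    IntegrableOn (fun x => ‖h x‖ ^ 2 / (1 - x) ^ 2) (Ioo c 1) := by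
  have hsub : Ioo c 1 ⊆ Ioo (0 : ℝ) 1 := Ioo_subset_Ioo_left (by linarith)
  rw [integrableOn_weightMeasure_iff measurableSet_Ioo hsub] at hI
  refine Integrable.mono' (hI.const_mul 16) ?_
    ((ae_restrict_iff' measurableSet_Ioo).2 (Eventually.of_forall fun x hx => ?_))
  · have h1 : Measurable fun x : ℝ => ((1 - x) ^ 2)⁻¹ := by fun_prop
    exact ((hm.mono_measure (Measure.restrict_mono hsub le_rfl)).norm.pow 2).mul
      h1.aestronglyMeasurable
  · rw [Real.norm_of_nonneg (by positivity)]
    have hx1 := hsub hx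
    have h1 : 0 < 1 - x := sub_pos.2 hx1.2
    have h2 : 1 / 2 ≤ x := hc.trans hx.1.le
    have hw : 1 / (1 - x) ^ 2 ≤ 16 * weight x := by
      unfold weight
      have h3 : (1 - x ^ 2) ^ 2 = (1 - x) ^ 2 * (1 + x) ^ 2 := by ring
      rw [h3, ← mul_div_assoc, div_le_div_iff₀ (by positivity) (by positivity)]
      have h4 : (1 + x) ^ 2 ≤ 16 * x ^ 2 := by nlinarith [hx1.2]
      nlinarith [mul_le_mul_of_nonneg_left h4 (sq_nonneg (1 - x))]
    calc ‖h x‖ ^ 2 / (1 - x) ^ 2 = 1 / (1 - x) ^ 2 * ‖h x‖ ^ 2 := by ring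
      _ ≤ 16 * weight x * ‖h x‖ ^ 2 := by gcongr
      _ = _ := by ring

lemma IsLocalDomainRep.near_one {f : ℝ → ℝ} (hf : ContinuousOn f (Ioo 0 1)) {g : ℝ → ℂ}
    (hg : IsLocalDomainRep f 1 g) :
    IntegrableAtFilter (fun x => ‖g x‖ ^ 2 / (1 - x) ^ 2 + ‖quasiDeriv g x‖ ^ 2)
      (𝓝[<] (1 : ℝ)) := by
  obtain ⟨s, hs, hsI⟩ := hg.integrable
  obtain ⟨t, ht, htI⟩ := hg.integrable_slExpr
  have hst := inter_mem hs ht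
  rw [nhdsWithin_Ioo_eq_nhdsLT (zero_lt_one' ℝ)] at hst
  obtain ⟨c₁, hc₁, hsub⟩ := (mem_nhdsLT_iff_exists_Ioo_subset' (zero_lt_one' ℝ)).1 hst
  have hc1 : max c₁ (1 / 2) < 1 := max_lt hc₁ (by norm_num)
  have hc2 : 1 / 2 ≤ max c₁ (1 / 2) := le_max_right _ _
  have hsub' : Ioo (max c₁ (1 / 2)) 1 ⊆ s ∩ t :=
    (Ioo_subset_Ioo_left (le_max_left _ _)).trans hsub
  have h1 := integrableOn_sq_div hc2 hg.ac.aestronglyMeasurable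
    (hsI.mono_set (hsub'.trans inter_subset_left))
  have h2 := integrableOn_sq_div hc2 (aestronglyMeasurable_slExpr hf hg.ac)
    (htI.mono_set (hsub'.trans inter_subset_right))
  exact ⟨_, Ioo_mem_nhdsLT hc1, h1.add (integrableOn_quasiDeriv_near_one
    ⟨by linarith, hc1⟩ hg.ac hg.ac_quasiDeriv h1 h2)⟩

/-- The bracket of two admissible functions tends to zero at the endpoint `0`. -/
lemma tendsto_bracket_zero {n : ℕ} {f : ℝ → ℝ} (hf : IsProfile n f) {g h B : ℝ → ℂ}
    (hg : IsLocalDomainRep f 0 g) (hh : IsLocalDomainRep f 0 h)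
    (hB : ∀ x ∈ Ioo (0 : ℝ) 1, ‖B x‖ ≤ ‖g x‖ * ‖quasiDeriv h x‖ + ‖quasiDeriv g x‖ * ‖h x‖) :
    Tendsto B (𝓝[>] 0) (𝓝 0) := by
  obtain ⟨M, hM⟩ := hg.near_zero hf
  obtain ⟨N, hN⟩ := hh.near_zero hf
  have hlim : Tendsto (fun x : ℝ => 2 * M * N * x) (𝓝[>] 0) (𝓝 0) := by
    have : Tendsto (fun x : ℝ => 2 * M * N * x) (𝓝 0) (𝓝 (2 * M * N * 0)) :=
      (continuous_const.mul continuous_id).tendsto 0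
    rw [mul_zero] at this
    exact this.mono_left nhdsWithin_le_nhds
  refine squeeze_zero_norm' ?_ hlim
  filter_upwards [hM, hN, Ioo_mem_nhdsGT (zero_lt_one' ℝ)] with x h1 h2 hx
  have hM0 : 0 ≤ M := (norm_nonneg _).trans h1.1
  have hN0 : 0 ≤ N := (norm_nonneg _).trans h2.1
  have hx0 := hx.1.le
  calc ‖B x‖ ≤ _ := hB x hx
    _ ≤ M * (N * x) + M * x * N := by
        have := h1.1
        have := h1.2
        have := h2.1
        have := h2.2
        gcongr
    _ = _ := by ring

/-- If the bracket of two admissible functions has a limit at the endpoint `1`, this limit is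
zero. -/
lemma bracket_limit_eq_zero {f : ℝ → ℝ} (hf : ContinuousOn f (Ioo 0 1)) {g h B : ℝ → ℂ}
    (hg : IsLocalDomainRep f 1 g) (hh : IsLocalDomainRep f 1 h)
    (hB : ∀ x ∈ Ioo (0 : ℝ) 1, ‖B x‖ ≤ ‖g x‖ * ‖quasiDeriv h x‖ + ‖quasiDeriv g x‖ * ‖h x‖)
    {L : ℂ} (hL : Tendsto B (𝓝[<] 1) (𝓝 L)) : L = 0 := by
  by_contra hL0
  have hLpos : 0 < ‖L‖ := norm_pos_iff.2 hL0
  obtain ⟨s, hs, hsI⟩ := hg.near_one hf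
  obtain ⟨t, ht, htI⟩ := hh.near_one hf
  have hev : ∀ᶠ x in 𝓝[<] (1 : ℝ), ‖L‖ / 2 < ‖B x‖ := hL.norm.eventually_const_lt (by linarith)
  obtain ⟨c, hc, hsub⟩ := (mem_nhdsLT_iff_exists_Ioo_subset' (zero_lt_one' ℝ)).1
    (inter_mem (inter_mem (inter_mem hs ht) hev) (Ioo_mem_nhdsLT (zero_lt_one' ℝ)))
  refine not_integrableOn_inv_one_sub (p := c) hc ?_
  have hI := ((hsI.mono_set fun x hx => (hsub hx).1.1.1).add
    (htI.mono_set fun x hx => (hsub hx).1.1.2)).const_mul (2 / ‖L‖)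
  refine Integrable.mono' hI (by fun_prop) ((ae_restrict_iff' measurableSet_Ioo).2
    (Eventually.of_forall fun x hx => ?_))
  have h1 : ‖L‖ / 2 < ‖B x‖ := (hsub hx).1.2
  have h2 := hB x (hsub hx).2
  have hpos : 0 < 1 - x := sub_pos.2 hx.2
  rw [norm_inv, Real.norm_of_nonneg hpos.le, Pi.add_apply, div_mul_eq_mul_div,
    le_div_iff₀ hLpos, inv_mul_le_iff₀ hpos]
  -- Arithmetic-geometric mean for `a/(1-x)` and `b`. Applied to both products in the bound on `B`,
  -- it makes `‖B‖/(1-x)` integrable, whereas `‖B‖ > ‖L‖/2` near `1`.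
  have e1 : ∀ a b : ℝ, 0 ≤ a → 0 ≤ b →
      2 * (a * b) ≤ (1 - x) * (a ^ 2 / (1 - x) ^ 2 + b ^ 2) := by
    intro a b ha hb
    have e2 : a = (1 - x) * (a / (1 - x)) := by field_simp
    set a' := a / (1 - x)
    rw [e2, mul_pow, mul_div_cancel_left₀ _ (by positivity)]
    nlinarith [mul_nonneg hpos.le (sq_nonneg (a' - b))]
  have e3 := e1 _ _ (norm_nonneg (g x)) (norm_nonneg (quasiDeriv h x))
  have e4 := e1 _ _ (norm_nonneg (h x)) (norm_nonneg (quasiDeriv g x))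
  nlinarith

/-! ### Solutions of `a g = z g` and the limit-point case -/

/-- The equation is the linear system `g' = Q/t²`, `Q' = (q - z w) g` for the pair `(g, Q)` with `Q
= p g'`, whose coefficients are continuous on `(0,1)`. -/
lemma exists_isSolution {f : ℝ → ℝ} (hf : ContinuousOn f (Ioo 0 1)) (z a b : ℂ) :
    ∃ g, IsSolution f z g ∧ g (1 / 2) = a ∧ quasiDeriv g (1 / 2) = b := by
  have hqz : ContinuousOn (fun t => (potential f t : ℂ) - z * weight t) (Ioo 0 1) :=
    (Complex.continuous_ofReal.comp_continuousOn (continuousOn_potential hf)).sub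
      (continuousOn_const.mul (Complex.continuous_ofReal.comp_continuousOn continuousOn_weight))
  have hinv : ContinuousOn (fun t : ℝ => ((t : ℂ) ^ 2)⁻¹) (Ioo 0 1) := by
    refine ContinuousOn.inv₀ (by fun_prop) fun t ht => ?_
    exact pow_ne_zero 2 (Complex.ofReal_ne_zero.2 ht.1.ne')
  obtain ⟨y, hy0, hy⟩ := exists_hasDerivAt_Ioo (E := ℂ × ℂ)
    (v := fun t p => (((t : ℂ) ^ 2)⁻¹ * p.2, ((potential f t : ℂ) - z * weight t) * p.1))
    (K := fun t => ‖((t : ℂ) ^ 2)⁻¹‖ + ‖(potential f t : ℂ) - z * weight t‖)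
    (by
      have h1 : MapsTo (fun p : ℝ × ℂ × ℂ => p.1) (Ioo 0 1 ×ˢ univ) (Ioo 0 1) := fun p hp => hp.1
      exact ((hinv.comp continuous_fst.continuousOn h1).mul (by fun_prop)).prodMk
        ((hqz.comp continuous_fst.continuousOn h1).mul (by fun_prop)))
    (hinv.norm.add hqz.norm) (fun t _ => by positivity)
    (fun t _ p p' => by
      have n1 : ‖p.1 - p'.1‖ ≤ ‖p - p'‖ := norm_fst_le (p - p')
      have n2 : ‖p.2 - p'.2‖ ≤ ‖p - p'‖ := norm_snd_le (p - p')
      rw [Prod.mk_sub_mk, ← mul_sub, ← mul_sub, Prod.norm_mk, norm_mul, norm_mul]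
      refine max_le ?_ ?_
      · exact mul_le_mul (le_add_of_nonneg_right (norm_nonneg _)) n2 (norm_nonneg _)
          (by positivity)
      · exact mul_le_mul (le_add_of_nonneg_left (norm_nonneg _)) n1 (norm_nonneg _)
          (by positivity))
    (fun t _ => by simp) (1 / 2) (a, b)
  have hd1 : ∀ t ∈ Ioo (0 : ℝ) 1, HasDerivAt (fun t => (y t).1) (((t : ℂ) ^ 2)⁻¹ * (y t).2) t :=
    fun t ht => (ContinuousLinearMap.fst ℝ ℂ ℂ).hasFDerivAt.comp_hasDerivAt t (hy t ht)
  have hd2 : ∀ t ∈ Ioo (0 : ℝ) 1, HasDerivAt (fun t => (y t).2)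
      (((potential f t : ℂ) - z * weight t) * (y t).1) t :=
    fun t ht => (ContinuousLinearMap.snd ℝ ℂ ℂ).hasFDerivAt.comp_hasDerivAt t (hy t ht)
  have hc1 : ContinuousOn (fun t => (y t).1) (Ioo 0 1) := fun t ht =>
    (hd1 t ht).continuousAt.continuousWithinAt
  have hc2 : ContinuousOn (fun t => (y t).2) (Ioo 0 1) := fun t ht =>
    (hd2 t ht).continuousAt.continuousWithinAt
  have hQ : EqOn (quasiDeriv fun t => (y t).1) (fun t => (y t).2) (Ioo 0 1) := fun t ht => by
    have : (t : ℂ) ^ 2 ≠ 0 := pow_ne_zero 2 (Complex.ofReal_ne_zero.2 ht.1.ne')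
    simp only [quasiDeriv, (hd1 t ht).deriv, leadCoeff]
    push_cast
    rw [mul_inv_cancel_left₀ this]
  refine ⟨fun t => (y t).1, ⟨isACLoc_of_hasDerivAt hd1 (hinv.mul hc2),
    (isACLoc_of_hasDerivAt hd2 (hqz.mul hc1)).congr hQ, Eventually.of_forall fun t ht => ?_⟩,
    congrArg Prod.fst hy0, ?_⟩
  · have hw : (weight t : ℂ) ≠ 0 := Complex.ofReal_ne_zero.2 (weight_pos ht).ne'
    simp only [slExpr, (hQ.eventuallyEq_of_mem (isOpen_Ioo.mem_nhds ht)).deriv_eq,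
      (hd2 t ht).deriv]
    field_simp
    ring
  · rw [hQ (by norm_num : (1 / 2 : ℝ) ∈ Ioo (0 : ℝ) 1)]
    exact congrArg Prod.snd hy0

/-- The bracket of two solutions of the same equation is constant. -/
lemma IsSolution.bracket_eq {f : ℝ → ℝ} {z : ℂ} {g h : ℝ → ℂ} (hg : IsSolution f z g)
    (hh : IsSolution f z h) {x y : ℝ} (hx : x ∈ Ioo (0 : ℝ) 1) (hy : y ∈ Ioo (0 : ℝ) 1) :
    g y * quasiDeriv h y - quasiDeriv g y * h y = g x * quasiDeriv h x - quasiDeriv g x * h x := by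
  have h1 := ((hg.ac.mul hh.ac_quasiDeriv).sub (hg.ac_quasiDeriv.mul hh.ac)).integral_eq_sub
    (F' := fun _ => 0) (by
      filter_upwards [hg.ac_quasiDeriv.ae_hasDerivAt, hh.ac_quasiDeriv.ae_hasDerivAt, hg.eqn,
        hh.eqn] with t h1 h2 h3 h4 ht
      refine (((hasDerivAt_of_isACLoc hg.ac hg.ac_quasiDeriv ht).mul (h2 ht)).sub
        ((h1 ht).mul (hasDerivAt_of_isACLoc hh.ac hh.ac_quasiDeriv ht))).congr_deriv ?_
      rw [deriv_quasiDeriv f g ht, deriv_quasiDeriv f h ht, h3 ht, h4 ht]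
      ring) (continuousOn_const.locallyIntegrableOn measurableSet_Ioo) hx hy
  rw [intervalIntegral.integral_zero] at h1
  exact (sub_eq_zero.1 h1.symm)

lemma IsSolution.isLocalDomainRep {f : ℝ → ℝ} {z : ℂ} {e : ℝ} {g : ℝ → ℂ}
    (hg : IsSolution f z g)
    (hI : IntegrableAtFilter (fun x => ‖g x‖ ^ 2) (𝓝[Ioo 0 1] e) weightMeasure) :
    IsLocalDomainRep f e g := by
  refine ⟨hg.ac, hg.ac_quasiDeriv, hI, ?_⟩
  obtain ⟨s, hs, hsI⟩ := hI
  refine ⟨s, hs, (hsI.const_mul (‖z‖ ^ 2)).congr (ae_restrict_of_ae ?_)⟩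
  refine ae_weightMeasure_iff.2 ?_
  filter_upwards [hg.eqn] with x hx hx'
  rw [hx hx', norm_mul, mul_pow]

/-- If every solution were square integrable near `e`, this would hold for the two solutions with
data `(1, 0)` and `(0, 1)` at `1/2`, whose bracket is constantly `1`. -/
lemma isLimitPoint_of_bracket {f : ℝ → ℝ} (hf : ContinuousOn f (Ioo 0 1)) {e : ℝ}
    (h : ∀ g h B : ℝ → ℂ, IsLocalDomainRep f e g → IsLocalDomainRep f e h →
      (∀ x ∈ Ioo (0 : ℝ) 1, ‖B x‖ ≤ ‖g x‖ * ‖quasiDeriv h x‖ + ‖quasiDeriv g x‖ * ‖h x‖) →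
      (∀ x ∈ Ioo (0 : ℝ) 1, B x = 1) → False) : IsLimitPoint f e := by
  intro z
  by_contra! hcon
  obtain ⟨g, hg, hg1, hg2⟩ := exists_isSolution hf z 1 0
  obtain ⟨k, hk, hk1, hk2⟩ := exists_isSolution hf z 0 1
  refine h g k (fun x => g x * quasiDeriv k x - quasiDeriv g x * k x)
    (hg.isLocalDomainRep (hcon g hg)) (hk.isLocalDomainRep (hcon k hk)) (fun x _ => ?_)
    fun x hx => ?_
  · exact (norm_sub_le _ _).trans (by rw [norm_mul, norm_mul])
  · rw [hg.bracket_eq hk (by norm_num : (1 / 2 : ℝ) ∈ Ioo (0 : ℝ) 1) hx, hg1, hg2, hk1, hk2]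
    simp

lemma IsProfile.isLimitPoint_zero {n : ℕ} {f : ℝ → ℝ} (hf : IsProfile n f) :
    IsLimitPoint f 0 := by
  refine isLimitPoint_of_bracket hf.continuousOn fun g h B hg hh hB hB1 => ?_
  have h1 := tendsto_bracket_zero hf hg hh hB
  have h2 : Tendsto B (𝓝[>] 0) (𝓝 1) := tendsto_const_nhds.congr' (by
    filter_upwards [Ioo_mem_nhdsGT (zero_lt_one' ℝ)] with x hx using (hB1 x hx).symm)
  exact zero_ne_one (tendsto_nhds_unique h1 h2)

lemma isLimitPoint_one {f : ℝ → ℝ} (hf : ContinuousOn f (Ioo 0 1)) : IsLimitPoint f 1 := by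
  refine isLimitPoint_of_bracket hf fun g h B hg hh hB hB1 => ?_
  have h2 : Tendsto B (𝓝[<] 1) (𝓝 1) := tendsto_const_nhds.congr' (by
    filter_upwards [Ioo_mem_nhdsLT (zero_lt_one' ℝ)] with x hx using (hB1 x hx).symm)
  exact one_ne_zero (bracket_limit_eq_zero hf hg hh hB h2)

/-! ### The weighted measure -/

lemma weightMeasure_absolutelyContinuous :
    weightMeasure ≪ volume.restrict (Ioo (0 : ℝ) 1) := withDensity_absolutelyContinuous _ _

lemma absolutelyContinuous_weightMeasure :
    volume.restrict (Ioo (0 : ℝ) 1) ≪ weightMeasure := by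
  rw [← Measure.ae_le_iff_absolutelyContinuous]
  intro s hs
  exact (ae_restrict_iff' measurableSet_Ioo).2 (ae_weightMeasure_iff.1 hs)

lemma integral_weightMeasure (F : ℝ → ℂ) :
    ∫ x, F x ∂weightMeasure = ∫ x in Ioo (0 : ℝ) 1, (weight x : ℂ) * F x := by
  unfold weightMeasure
  rw [integral_withDensity_eq_integral_toReal_smul measurable_weight.ennreal_ofReal
    (Eventually.of_forall fun _ => ENNReal.ofReal_lt_top)]
  refine setIntegral_congr_fun measurableSet_Ioo fun x hx => ?_
  rw [ENNReal.toReal_ofReal (weight_pos hx).le, Complex.real_smul]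

lemma integrable_weightMeasure_iff {F : ℝ → ℂ} :
    Integrable F weightMeasure ↔ IntegrableOn (fun x => (weight x : ℂ) * F x) (Ioo 0 1) := by
  unfold weightMeasure
  rw [integrable_withDensity_iff_integrable_smul' measurable_weight.ennreal_ofReal
      (Eventually.of_forall fun _ => ENNReal.ofReal_lt_top)]
  refine integrable_congr ((ae_restrict_iff' measurableSet_Ioo).2
    (Eventually.of_forall fun x hx => ?_))
  simp only
  rw [ENNReal.toReal_ofReal (weight_pos hx).le, Complex.real_smul]

/-- On compact subintervals `w` is bounded below, and there `L²` is contained in `L¹`. -/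
lemma locallyIntegrableOn_of_memLp {F : ℝ → ℂ} (hF : MemLp F 2 weightMeasure) :
    LocallyIntegrableOn F (Ioo 0 1) := by
  have hm : AEStronglyMeasurable F (volume.restrict (Ioo 0 1)) :=
    hF.aestronglyMeasurable.mono_ac absolutelyContinuous_weightMeasure
  have hI : IntegrableOn (fun x => ‖F x‖ ^ 2) (Ioo 0 1) weightMeasure :=
    ((memLp_two_iff_integrable_sq_norm hF.aestronglyMeasurable).1 hF).integrableOn
  rw [integrableOn_weightMeasure_iff measurableSet_Ioo le_rfl] at hI
  intro x hx
  have ha : 0 < x / 2 := by linarith [hx.1]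
  have hb : (x + 1) / 2 < 1 := by linarith [hx.2]
  have hsub := Icc_subset_Ioo_zero_one ha hb
  refine ⟨Icc (x / 2) ((x + 1) / 2), mem_nhdsWithin_of_mem_nhds
    (Icc_mem_nhds (by linarith [hx.1]) (by linarith [hx.2])), ?_⟩
  refine Integrable.mono' ((integrableOn_const (C := (1 : ℝ)) (by simp)).add
    ((hI.mono_set hsub).const_mul ((x / 2) ^ 2)⁻¹))
    (hm.mono_measure (Measure.restrict_mono hsub le_rfl))
    ((ae_restrict_iff' measurableSet_Icc).2 (Eventually.of_forall fun y hy => ?_))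
  have h1 : (x / 2) ^ 2 ≤ weight y :=
    (pow_le_pow_left₀ ha.le hy.1 2).trans (sq_le_weight (hsub hy))
  have h2 : ‖F y‖ ^ 2 ≤ ((x / 2) ^ 2)⁻¹ * (weight y * ‖F y‖ ^ 2) := by
    rw [inv_mul_eq_div, le_div_iff₀ (by positivity), mul_comm]
    gcongr
  rw [Pi.add_apply]
  nlinarith [sq_nonneg (‖F y‖ - 1)]

lemma memLp_of_continuousOn {F : ℝ → ℂ} (hF : ContinuousOn F (Ioo 0 1)) {a b : ℝ} (ha : 0 < a)
    (hb : b < 1) (hz : ∀ x, x ∉ Ioo a b → F x = 0) : MemLp F 2 weightMeasure := by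
  have hm : AEStronglyMeasurable F weightMeasure :=
    (hF.aestronglyMeasurable measurableSet_Ioo).mono_ac weightMeasure_absolutelyContinuous
  rw [memLp_two_iff_integrable_sq_norm hm]
  have hsub := Icc_subset_Ioo_zero_one ha hb
  have h1 : IntegrableOn (fun x => ‖F x‖ ^ 2) (Icc a b) weightMeasure := by
    rw [integrableOn_weightMeasure_iff measurableSet_Icc hsub]
    exact ((continuousOn_weight.mul (hF.norm.pow 2)).mono hsub).integrableOn_Icc
  refine (integrableOn_iff_integrable_of_support_subset fun x hx => ?_).1 h1
  by_contra h
  exact hx (by simp [hz x fun h' => h (Ioo_subset_Icc_self h')])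

/-! ### Symmetry of the maximal operator -/

lemma IsDomainRep.memLp_self {f : ℝ → ℝ} {u : WeightedL2} {g : ℝ → ℂ} (hg : IsDomainRep f u g) :
    MemLp g 2 weightMeasure := (memLp_congr_ae hg.ae_eq).1 (Lp.memLp u)

lemma IsDomainRep.isLocalDomainRep {f : ℝ → ℝ} {u : WeightedL2} {g : ℝ → ℂ}
    (hg : IsDomainRep f u g) (e : ℝ) : IsLocalDomainRep f e g where
  ac := hg.ac
  ac_quasiDeriv := hg.ac_quasiDeriv
  integrable := ((memLp_two_iff_integrable_sq_norm
    hg.memLp_self.aestronglyMeasurable).1 hg.memLp_self).integrableAtFilter _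
  integrable_slExpr := ((memLp_two_iff_integrable_sq_norm
    hg.memLp.aestronglyMeasurable).1 hg.memLp).integrableAtFilter _

/-- Green's formula: the difference of the two integrands, times `w`, is the derivative of the
sesquilinear bracket `B`. As this derivative is integrable, `B` has limits at both endpoints, and
both limits are zero. -/
lemma integral_slExpr_symm {n : ℕ} {f : ℝ → ℝ} (hf : IsProfile n f) {u v : WeightedL2}
    {g h : ℝ → ℂ} (hg : IsDomainRep f u g) (hh : IsDomainRep f v h) :
    ∫ x, h x * star (slExpr f g x) ∂weightMeasure
      = ∫ x, slExpr f h x * star (g x) ∂weightMeasure := by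
  have hI1 : Integrable (fun x => h x * star (slExpr f g x)) weightMeasure :=
    hh.memLp_self.integrable_mul hg.memLp.star
  have hI2 : Integrable (fun x => slExpr f h x * star (g x)) weightMeasure :=
    hh.memLp.integrable_mul hg.memLp_self.star
  rw [← sub_eq_zero, ← integral_sub hI1 hI2, integral_weightMeasure]
  have hkI := integrable_weightMeasure_iff.1 (hI1.sub hI2)
  set k : ℝ → ℂ := fun x => (weight x : ℂ) * (h x * star (slExpr f g x) - slExpr f h x * star (g x))
    with hk
  set B : ℝ → ℂ := fun x => star (g x) * quasiDeriv h x - star (quasiDeriv g x) * h x with hB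
  have hBAC : IsACLoc B := (hg.ac.conj.mul hh.ac_quasiDeriv).sub (hg.ac_quasiDeriv.conj.mul hh.ac)
  -- Extended by zero, the integrand has a primitive continuous on all of `ℝ`; its values at `0` and
  -- `1` are the limits of `B`.
  have hk'I : Integrable ((Ioo (0 : ℝ) 1).indicator k) := hkI.integrable_indicator measurableSet_Ioo
  have hBd : ∀ᵐ x, x ∈ Ioo (0 : ℝ) 1 → HasDerivAt B ((Ioo (0 : ℝ) 1).indicator k x) x := by
    filter_upwards [hg.ac_quasiDeriv.ae_hasDerivAt, hh.ac_quasiDeriv.ae_hasDerivAt]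
      with x h1 h2 hx
    refine (((hasDerivAt_of_isACLoc hg.ac hg.ac_quasiDeriv hx).star.mul (h2 hx)).sub
      ((h1 hx).star.mul (hasDerivAt_of_isACLoc hh.ac hh.ac_quasiDeriv hx))).congr_deriv ?_
    rw [deriv_quasiDeriv f g hx, deriv_quasiDeriv f h hx, indicator_of_mem hx]
    simp only [hk, star_sub, star_mul', star_div₀, star_pow, RCLike.star_def, Complex.conj_ofReal]
    ring
  have hhalf : (1 / 2 : ℝ) ∈ Ioo (0 : ℝ) 1 := by norm_num
  have hBx : ∀ x ∈ Ioo (0 : ℝ) 1,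
      B (1 / 2) + ∫ t in (1 / 2)..x, (Ioo (0 : ℝ) 1).indicator k t = B x := fun x hx => by
    rw [hBAC.integral_eq_sub hBd (hk'I.locallyIntegrable.locallyIntegrableOn _) hhalf hx]
    ring
  have hcont : Continuous fun x =>
      B (1 / 2) + ∫ t in (1 / 2)..x, (Ioo (0 : ℝ) 1).indicator k t :=
    continuous_const.add (intervalIntegral.continuous_primitive
      (fun a b => hk'I.intervalIntegrable) _)
  have hBb : ∀ x ∈ Ioo (0 : ℝ) 1,
      ‖B x‖ ≤ ‖g x‖ * ‖quasiDeriv h x‖ + ‖quasiDeriv g x‖ * ‖h x‖ := fun x _ =>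
    (norm_sub_le _ _).trans (by rw [norm_mul, norm_mul, norm_star, norm_star])
  have h0 : B (1 / 2) + ∫ t in (1 / 2)..0, (Ioo (0 : ℝ) 1).indicator k t = 0 := by
    refine tendsto_nhds_unique ((hcont.tendsto 0).mono_left nhdsWithin_le_nhds)
      ((tendsto_bracket_zero hf (hg.isLocalDomainRep 0) (hh.isLocalDomainRep 0) hBb).congr' ?_)
    filter_upwards [Ioo_mem_nhdsGT (zero_lt_one' ℝ)] with x hx using (hBx x hx).symm
  have h1 : B (1 / 2) + ∫ t in (1 / 2)..1, (Ioo (0 : ℝ) 1).indicator k t = 0 := by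
    refine bracket_limit_eq_zero hf.continuousOn (hg.isLocalDomainRep 1) (hh.isLocalDomainRep 1)
      hBb (((hcont.tendsto 1).mono_left nhdsWithin_le_nhds).congr' ?_)
    filter_upwards [Ioo_mem_nhdsLT (zero_lt_one' ℝ)] with x hx using hBx x hx
  have h2 : ∫ t in (0 : ℝ)..1, (Ioo (0 : ℝ) 1).indicator k t = 0 := by
    rw [← intervalIntegral.integral_interval_sub_left (a := 1 / 2) hk'I.intervalIntegrable
      hk'I.intervalIntegrable]
    linear_combination h1 - h0
  rw [intervalIntegral.integral_of_le zero_le_one, integral_Ioc_eq_integral_Ioo,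
    setIntegral_indicator measurableSet_Ioo, inter_self] at h2
  exact h2

lemma inner_weightedL2 (u v : WeightedL2) :
    inner ℂ u v = ∫ x, v x * star (u x) ∂weightMeasure := by
  rw [L2.inner_def]
  rfl

lemma isFormalAdjoint_maximalOperator {n : ℕ} {f : ℝ → ℝ} (hf : IsProfile n f) :
    (maximalOperator f).IsFormalAdjoint (maximalOperator f) := by
  intro u v
  obtain ⟨g, hg⟩ := u.2
  obtain ⟨h, hh⟩ := v.2
  rw [inner_weightedL2, inner_weightedL2]
  calc ∫ x, (v : WeightedL2) x * star (maximalOperator f u x) ∂weightMeasure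
      = ∫ x, h x * star (slExpr f g x) ∂weightMeasure := by
        refine integral_congr_ae ?_
        filter_upwards [hh.ae_eq, maximalOperator_apply_ae_eq u hg] with x h1 h2
        rw [h1, h2]
    _ = ∫ x, slExpr f h x * star (g x) ∂weightMeasure := integral_slExpr_symm hf hg hh
    _ = _ := by
        refine integral_congr_ae ?_
        filter_upwards [hg.ae_eq, maximalOperator_apply_ae_eq v hh] with x h1 h2
        rw [h1, h2]

/-! ### Test functions in the domain -/

lemma isACLoc_ofReal : IsACLoc fun x : ℝ => (x : ℂ) :=
  isACLoc_of_contDiffOn Complex.ofRealCLM.contDiff.contDiffOn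

lemma hasDerivAt_ofReal' (x : ℝ) : HasDerivAt (fun x : ℝ => (x : ℂ)) 1 x := by
  exact (hasDerivAt_id (x : ℂ)).comp_ofReal

/-- For `g = G/ρ` one has `p g' = ρ G' - G`. -/
lemma quasiDeriv_mul_inv {G G' : ℝ → ℂ} (hG : ∀ x ∈ Ioo (0 : ℝ) 1, HasDerivAt G (G' x) x) :
    EqOn (quasiDeriv fun x => G x * (x : ℂ)⁻¹) (fun x => (x : ℂ) * G' x - G x) (Ioo 0 1) := by
  intro x hx
  have hx0 : (x : ℂ) ≠ 0 := Complex.ofReal_ne_zero.2 hx.1.ne'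
  have h : HasDerivAt (fun x => G x * (x : ℂ)⁻¹) _ x := (hG x hx).mul (hasDerivAt_ofReal_inv hx)
  simp only [quasiDeriv, h.deriv, leadCoeff]
  push_cast
  field_simp
  ring

/-- For `g = G/ρ` one has `(p g')' = ρ G''`. -/
lemma slExpr_mul_inv {f : ℝ → ℝ} {G G' : ℝ → ℂ} (hG : ∀ x ∈ Ioo (0 : ℝ) 1, HasDerivAt G (G' x) x)
    {x : ℝ} (hx : x ∈ Ioo (0 : ℝ) 1) {G'' : ℂ} (hG' : HasDerivAt G' G'' x) :
    slExpr f (fun x => G x * (x : ℂ)⁻¹) x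
      = (weight x : ℂ)⁻¹ * (-((x : ℂ) * G'') + (potential f x : ℂ) * (G x * (x : ℂ)⁻¹)) := by
  have h : HasDerivAt (fun x : ℝ => (x : ℂ) * G' x - G x) _ x :=
    ((hasDerivAt_ofReal' x).mul hG').sub (hG x hx)
  simp only [slExpr,
    ((quasiDeriv_mul_inv hG).eventuallyEq_of_mem (isOpen_Ioo.mem_nhds hx)).deriv_eq, h.deriv]
  ring

lemma isACLoc_mul_inv {G G' : ℝ → ℂ} (hG : ∀ x ∈ Ioo (0 : ℝ) 1, HasDerivAt G (G' x) x)
    (hG' : IsACLoc G') : IsACLoc (fun x => G x * (x : ℂ)⁻¹) ∧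
      IsACLoc (quasiDeriv fun x => G x * (x : ℂ)⁻¹) := by
  have hGAC := isACLoc_of_hasDerivAt hG hG'.continuousOn
  exact ⟨hGAC.mul isACLoc_ofReal_inv,
    ((isACLoc_ofReal.mul hG').sub hGAC).congr (quasiDeriv_mul_inv hG)⟩

lemma IsTest.slExpr_eqOn {φ : ℝ → ℝ} (hφ : IsTest φ) (f : ℝ → ℝ) :
    EqOn (slExpr f fun x => (φ x : ℂ) * (x : ℂ)⁻¹) (fun x => (weight x : ℂ)⁻¹ *
      (-((x : ℂ) * ((_root_.deriv (_root_.deriv φ) x : ℝ) : ℂ))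
        + (potential f x : ℂ) * ((φ x : ℂ) * (x : ℂ)⁻¹))) (Ioo 0 1) := fun x hx =>
  slExpr_mul_inv (fun x _ => (hφ.hasDerivAt x).ofReal_comp) hx (hφ.deriv.hasDerivAt x).ofReal_comp

/-- Test functions are divided by `x` because then `(p g')' = x φ''` has no first-order term, so
that the weak equation involves only second derivatives. The compact support keeps away from the
singular endpoints. -/
lemma IsTest.exists_isDomainRep {f : ℝ → ℝ} (hf : ContinuousOn f (Ioo 0 1)) {φ : ℝ → ℝ}
    (hφ : IsTest φ) : ∃ u, IsDomainRep f u fun x => (φ x : ℂ) * (x : ℂ)⁻¹ := by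
  obtain ⟨a, b, ha, hab, hb, hz⟩ := hφ.exists_Icc
  obtain ⟨a', b', ha', hab', hb', hz'⟩ := hφ.deriv.deriv.exists_Icc
  have hc : ContinuousOn (fun x => (φ x : ℂ) * (x : ℂ)⁻¹) (Ioo 0 1) :=
    (Complex.continuous_ofReal.comp hφ.contDiff.continuous).continuousOn.mul
      continuousOn_ofReal_inv
  have hL : MemLp (fun x => (φ x : ℂ) * (x : ℂ)⁻¹) 2 weightMeasure :=
    memLp_of_continuousOn hc ha hb fun x hx => by simp [hz x hx]
  obtain ⟨h1, h2⟩ := isACLoc_mul_inv (G := fun x => (φ x : ℂ))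
    (fun x _ => (hφ.hasDerivAt x).ofReal_comp) hφ.deriv.isACLoc
  refine ⟨hL.toLp _, hL.coeFn_toLp, h1, h2, ?_⟩
  refine (memLp_congr_ae (ae_weightMeasure_iff.2 (Eventually.of_forall (hφ.slExpr_eqOn f)))).2 ?_
  refine memLp_of_continuousOn (a := min a a') (b := max b b') ?_ (lt_min ha ha')
    (max_lt hb hb') fun x hx => ?_
  · refine ContinuousOn.mul (ContinuousOn.inv₀
      (Complex.continuous_ofReal.comp_continuousOn continuousOn_weight)
      fun x hx => Complex.ofReal_ne_zero.2 (weight_pos hx).ne') (ContinuousOn.add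
      (Continuous.continuousOn ?_) (ContinuousOn.mul
      (Complex.continuous_ofReal.comp_continuousOn (continuousOn_potential hf)) hc))
    exact (Complex.continuous_ofReal.mul
      (Complex.continuous_ofReal.comp hφ.deriv.deriv.contDiff.continuous)).neg
  · have e1 := hz x fun h => hx ⟨(min_le_left _ _).trans_lt h.1, h.2.trans_le (le_max_left _ _)⟩
    have e2 := hz' x fun h => hx ⟨(min_le_right _ _).trans_lt h.1, h.2.trans_le (le_max_right _ _)⟩
    simp [e1, e2]

lemma IsTest.eq_zero {φ : ℝ → ℝ} (hφ : IsTest φ) {x : ℝ} (hx : x ∉ Ioo (0 : ℝ) 1) : φ x = 0 :=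
  image_eq_zero_of_notMem_tsupport fun h => hx (hφ.subset h)

lemma IsTest.integral_weightMeasure {φ : ℝ → ℝ} (hφ : IsTest φ) (v : ℝ → ℂ) :
    ∫ x, v x * star ((φ x : ℂ) * (x : ℂ)⁻¹) ∂weightMeasure
      = ∫ x, (φ x : ℂ) * ((weight x : ℂ) * (x : ℂ)⁻¹ * v x) := by
  have h0 : ∀ x, x ∉ Ioo (0 : ℝ) 1 → (φ x : ℂ) * ((weight x : ℂ) * (x : ℂ)⁻¹ * v x) = 0 :=
    fun x hx => by simp [hφ.eq_zero hx]
  rw [WaveMap.integral_weightMeasure, ← setIntegral_eq_integral_of_forall_compl_eq_zero h0]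
  refine setIntegral_congr_fun measurableSet_Ioo fun x hx => ?_
  simp only [star_mul', star_inv₀, RCLike.star_def, Complex.conj_ofReal]
  ring

lemma locallyIntegrableOn_weight_mul {v : ℝ → ℂ} (hv : LocallyIntegrableOn v (Ioo 0 1)) :
    LocallyIntegrableOn (fun x => (weight x : ℂ) * (x : ℂ)⁻¹ * v x) (Ioo 0 1) := by
  refine (locallyIntegrableOn_mul_continuousOn hv ((Complex.continuous_ofReal.comp_continuousOn
    continuousOn_weight).mul continuousOn_ofReal_inv)).congr (Eventually.of_forall fun x => ?_)
  exact mul_comm _ _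

/-- An element `v` orthogonal to every `φ/x` satisfies `∫ φ w v / x = 0` for all test functions `φ`,
so `v = 0` almost everywhere. -/
lemma dense_maximalDomain {f : ℝ → ℝ} (hf : ContinuousOn f (Ioo 0 1)) :
    Dense ((maximalOperator f).domain : Set WeightedL2) := by
  rw [Submodule.dense_iff_topologicalClosure_eq_top, Submodule.topologicalClosure_eq_top_iff,
    Submodule.eq_bot_iff]
  intro v hv
  have hvI := locallyIntegrableOn_of_memLp (Lp.memLp v)
  have h := ae_eq_zero_of_forall_isTest (locallyIntegrableOn_weight_mul hvI) fun φ hφ => by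
    obtain ⟨u, hu⟩ := hφ.exists_isDomainRep hf
    have h1 := (Submodule.mem_orthogonal _ _).1 hv u ⟨_, hu⟩
    rw [inner_weightedL2] at h1
    rw [← hφ.integral_weightMeasure, ← h1]
    refine integral_congr_ae ?_
    filter_upwards [hu.ae_eq] with x hx
    rw [hx]
  rw [Lp.eq_zero_iff_ae_eq_zero]
  refine ae_weightMeasure_iff.2 ?_
  filter_upwards [h] with x hx hx'
  have h1 : (weight x : ℂ) ≠ 0 := Complex.ofReal_ne_zero.2 (weight_pos hx').ne'
  have h2 : (x : ℂ) ≠ 0 := Complex.ofReal_ne_zero.2 hx'.1.ne'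
  simpa [h1, h2] using hx hx'

/-! ### Regularity of the domain of the adjoint -/

/-- Elliptic regularity in one dimension. The hypothesis says that `(x v)'' = k` weakly, with `k =
(q v - w h)/x` locally integrable. So `x v` differs from the double primitive `K` of `k` by an
affine function, and `v` has the representative `G/x` with `G'` locally absolutely continuous. -/
lemma exists_isDomainRep_of_forall_isTest {f : ℝ → ℝ} (hf : ContinuousOn f (Ioo 0 1))
    {v h : WeightedL2} (H : ∀ φ, IsTest φ →
      ∫ x, v x * star (slExpr f (fun x => (φ x : ℂ) * (x : ℂ)⁻¹) x) ∂weightMeasure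
        = ∫ x, h x * star ((φ x : ℂ) * (x : ℂ)⁻¹) ∂weightMeasure) :
    ∃ g, IsDomainRep f v g ∧ slExpr f g =ᵐ[weightMeasure] h := by
  have hvI := locallyIntegrableOn_of_memLp (Lp.memLp v)
  have hhI := locallyIntegrableOn_of_memLp (Lp.memLp h)
  have hqc : ContinuousOn (fun x => (potential f x : ℂ)) (Ioo 0 1) :=
    Complex.continuous_ofReal.comp_continuousOn (continuousOn_potential hf)
  have hqvI : LocallyIntegrableOn (fun x => (potential f x : ℂ) * (x : ℂ)⁻¹ * v x) (Ioo 0 1) := by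
    refine (locallyIntegrableOn_mul_continuousOn hvI (hqc.mul continuousOn_ofReal_inv)).congr
      (Eventually.of_forall fun x => ?_)
    exact mul_comm _ _
  have hxvI : LocallyIntegrableOn (fun x : ℝ => (x : ℂ) * v x) (Ioo 0 1) := by
    simpa only [mul_comm] using
      locallyIntegrableOn_mul_continuousOn hvI Complex.continuous_ofReal.continuousOn
  have hwhI := locallyIntegrableOn_weight_mul hhI
  set k : ℝ → ℂ := fun x => (potential f x : ℂ) * (x : ℂ)⁻¹ * v x
    - (weight x : ℂ) * (x : ℂ)⁻¹ * h x with hk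
  have hkI : LocallyIntegrableOn k (Ioo 0 1) := hqvI.sub hwhI
  have hhalf : (1 / 2 : ℝ) ∈ Ioo (0 : ℝ) 1 := by norm_num
  set K₁ : ℝ → ℂ := fun x => ∫ t in (1 / 2)..x, k t with hK₁
  have hK₁AC : IsACLoc K₁ := isACLoc_integral hkI hhalf
  have hK₁d := ae_hasDerivAt_integral hkI hhalf
  set K : ℝ → ℂ := fun x => ∫ t in (1 / 2)..x, K₁ t with hK
  have hKd : ∀ x ∈ Ioo (0 : ℝ) 1, HasDerivAt K (K₁ x) x := fun x hx =>
    intervalIntegral.integral_hasDerivAt_right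
      (intervalIntegrable_of_locallyIntegrableOn hK₁AC.locallyIntegrableOn hhalf hx)
      (hK₁AC.continuousOn.stronglyMeasurableAtFilter isOpen_Ioo x hx)
      (hK₁AC.continuousOn.continuousAt (isOpen_Ioo.mem_nhds hx))
  have hKAC : IsACLoc K := isACLoc_of_hasDerivAt hKd hK₁AC.continuousOn
  have hweak : ∀ φ, IsTest φ →
      ∫ x, ((deriv (deriv φ) x : ℝ) : ℂ) * ((x : ℂ) * v x - K x) = 0 := by
    intro φ hφ
    have i1 := hφ.deriv.deriv.integrable_mul hxvI
    have i2 := hφ.deriv.deriv.integrable_mul hKAC.locallyIntegrableOn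
    have i3 := hφ.integrable_mul hqvI
    have i4 := hφ.integrable_mul hwhI
    -- Two integrations by parts move both derivatives from `φ` to `K`.
    have e1 : ∫ x, ((deriv (deriv φ) x : ℝ) : ℂ) * K x = ∫ x, (φ x : ℂ) * k x := by
      rw [hφ.deriv.integral_deriv_mul hKAC (Eventually.of_forall hKd) hK₁AC.locallyIntegrableOn,
        hφ.integral_deriv_mul hK₁AC hK₁d hkI, neg_neg]
    have e2 : ∫ x, (φ x : ℂ) * k x
        = (∫ x, (φ x : ℂ) * ((potential f x : ℂ) * (x : ℂ)⁻¹ * v x))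
          - ∫ x, (φ x : ℂ) * ((weight x : ℂ) * (x : ℂ)⁻¹ * h x) := by
      rw [← integral_sub i3 i4]
      simp only [hk, mul_sub]
    have e3 := H φ hφ
    rw [hφ.integral_weightMeasure, integral_weightMeasure] at e3
    have e4 : ∫ x in Ioo (0 : ℝ) 1,
        (weight x : ℂ) * (v x * star (slExpr f (fun x => (φ x : ℂ) * (x : ℂ)⁻¹) x))
        = (∫ x, (φ x : ℂ) * ((potential f x : ℂ) * (x : ℂ)⁻¹ * v x))
          - ∫ x, ((deriv (deriv φ) x : ℝ) : ℂ) * ((x : ℂ) * v x) := by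
      have h0 : ∀ x, x ∉ Ioo (0 : ℝ) 1 → (φ x : ℂ) * ((potential f x : ℂ) * (x : ℂ)⁻¹ * v x)
          - ((deriv (deriv φ) x : ℝ) : ℂ) * ((x : ℂ) * v x) = 0 := fun x hx => by
        simp [hφ.eq_zero hx, hφ.deriv.deriv.eq_zero hx]
      rw [← integral_sub i3 i1, ← setIntegral_eq_integral_of_forall_compl_eq_zero h0]
      refine setIntegral_congr_fun measurableSet_Ioo fun x hx => ?_
      have hw : (weight x : ℂ) ≠ 0 := Complex.ofReal_ne_zero.2 (weight_pos hx).ne'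
      simp only [hφ.slExpr_eqOn f hx, star_mul', star_add, star_neg, star_inv₀, RCLike.star_def,
        Complex.conj_ofReal]
      field_simp
      ring
    simp only [mul_sub]
    rw [integral_sub i1 i2, e1, e2, ← e3, e4]
    ring
  obtain ⟨c, d, hcd⟩ := exists_ae_eq_affine (hxvI.sub hKAC.locallyIntegrableOn) hweak
  set G : ℝ → ℂ := fun x => K x + (c + d * x) with hG
  have hGd : ∀ x ∈ Ioo (0 : ℝ) 1, HasDerivAt G (K₁ x + d) x := fun x hx =>
    ((hKd x hx).add (((hasDerivAt_ofReal' x).const_mul d).const_add c)).congr_deriv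
      (by rw [mul_one])
  have hdAC : IsACLoc fun _ => d := isACLoc_of_contDiffOn contDiffOn_const
  obtain ⟨h1, h2⟩ := isACLoc_mul_inv hGd (hK₁AC.add hdAC)
  have hvg : v =ᵐ[weightMeasure] fun x => G x * (x : ℂ)⁻¹ := by
    refine ae_weightMeasure_iff.2 ?_
    filter_upwards [hcd] with x hx hx'
    have hx0 : (x : ℂ) ≠ 0 := Complex.ofReal_ne_zero.2 hx'.1.ne'
    rw [eq_mul_inv_iff_mul_eq₀ hx0]
    have : (x : ℂ) * v x - K x = c + d * x := hx hx'
    simp only [hG]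
    linear_combination this
  have hsl : slExpr f (fun x => G x * (x : ℂ)⁻¹) =ᵐ[weightMeasure] h := by
    refine ae_weightMeasure_iff.2 ?_
    filter_upwards [ae_weightMeasure_iff.1 hvg, hK₁d] with x h3 h4 hx
    have hx0 : (x : ℂ) ≠ 0 := Complex.ofReal_ne_zero.2 hx.1.ne'
    have hw : (weight x : ℂ) ≠ 0 := Complex.ofReal_ne_zero.2 (weight_pos hx).ne'
    rw [slExpr_mul_inv hGd hx ((h4 hx).add_const d), ← h3 hx]
    simp only [hk]
    field_simp
    ring
  exact ⟨_, ⟨hvg, h1, h2, (memLp_congr_ae hsl).2 (Lp.memLp h)⟩, hsl⟩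

/-- Pairing `v` in the domain of the adjoint with the elements `φ/x` alone already yields the weak
equation with right-hand side `A* v`. -/
lemma adjoint_maximalOperator_le {f : ℝ → ℝ} (hf : ContinuousOn f (Ioo 0 1)) :
    (maximalOperator f).adjoint ≤ maximalOperator f := by
  have hdense := dense_maximalDomain hf
  have key : ∀ v : (maximalOperator f).adjoint.domain, ∃ g, IsDomainRep f v g ∧
      slExpr f g =ᵐ[weightMeasure] (maximalOperator f).adjoint v := by
    intro v
    refine exists_isDomainRep_of_forall_isTest hf fun φ hφ => ?_
    obtain ⟨u, hu⟩ := hφ.exists_isDomainRep hf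
    have h1 := (LinearPMap.adjoint_isFormalAdjoint hdense).symm ⟨u, _, hu⟩ v
    rw [inner_weightedL2, inner_weightedL2] at h1
    refine (integral_congr_ae ?_).trans (h1.trans (integral_congr_ae ?_))
    · filter_upwards [maximalOperator_apply_ae_eq ⟨u, _, hu⟩ hu] with x hx
      rw [hx]
    · filter_upwards [hu.ae_eq] with x hx
      rw [hx]
  refine ⟨fun v hv => ?_, fun v u huv => ?_⟩
  · obtain ⟨g, hg, -⟩ := key ⟨v, hv⟩
    exact ⟨g, hg⟩
  · obtain ⟨g, hg, hg'⟩ := key v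
    rw [huv] at hg
    exact Lp.ext (hg'.symm.trans (maximalOperator_apply_ae_eq u hg).symm)

theorem IsProfile.isSelfAdjoint_maximalOperator {n : ℕ} {f : ℝ → ℝ} (hf : IsProfile n f) :
    IsSelfAdjoint (maximalOperator f) :=
  LinearPMap.isSelfAdjoint_def.2 (le_antisymm (adjoint_maximalOperator_le hf.continuousOn)
    ((isFormalAdjoint_maximalOperator hf).le_adjoint (dense_maximalDomain hf.continuousOn)))

/-! ### Frobenius indices -/

lemma deriv_leadCoeff_div {x : ℝ} (hx : x ≠ 0) : deriv leadCoeff x / leadCoeff x = 2 / x := by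
  have h : HasDerivAt leadCoeff (2 * x) x := by
    simpa [leadCoeff] using! hasDerivAt_pow 2 x
  rw [h.deriv, leadCoeff]
  field_simp

/-- Here `b = 2` and `c = -q`, with `q(0) = 2` because `f 0 = 0`. The indicial polynomial is `x (x -
1) + 2x - 2 = (x + 2)(x - 1)`. -/
lemma hasFrobeniusIndices_zero {f : ℝ → ℝ} (hf : AnalyticWithinAt ℝ f (Icc 0 1) 0)
    (hf0 : f 0 = 0) : HasFrobeniusIndices f 0 (-2) 1 := by
  have hx : AnalyticWithinAt ℝ (fun x : ℝ => x) (Icc 0 1) 0 := analyticWithinAt_id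
  have hc : ∀ c : ℝ, AnalyticWithinAt ℝ (fun _ : ℝ => c) (Icc 0 1) 0 := fun c =>
    analyticWithinAt_const
  have hcos : AnalyticWithinAt ℝ (fun x => Real.cos (2 * f x)) (Icc 0 1) 0 :=
    Real.analyticAt_cos.comp_analyticWithinAt ((hc 2).mul hf)
  have hD := (hc 1).sub (hx.pow 2)
  refine ⟨fun _ => 2, fun x => -potential f x, analyticWithinAt_const, ?_, ?_, fun x => ?_⟩
  · exact ((((hc 2).mul hD).mul hcos).sub (hx.pow 2)).div (hD.pow 2) (by simp) |>.neg
  · filter_upwards [self_mem_nhdsWithin] with x hx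
    have := hx.1.ne'
    refine ⟨by rw [deriv_leadCoeff_div this, sub_zero], ?_⟩
    rw [leadCoeff, sub_zero, neg_div]
  · simp [potential, hf0]
    ring

/-- Since `p'/p = 2/x` is regular at `1`, `b` vanishes there. The cosine carries a factor `1 - x²`,
so `c(1) = 1/4` whatever the value of `f` at `1`, and the polynomial is `(x - 1/2)²`. -/
lemma hasFrobeniusIndices_one {f : ℝ → ℝ} (hf : AnalyticWithinAt ℝ f (Icc 0 1) 1) :
    HasFrobeniusIndices f 1 (1 / 2) (1 / 2) := by
  have hx : AnalyticWithinAt ℝ (fun x : ℝ => x) (Icc 0 1) 1 := analyticWithinAt_id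
  have hc : ∀ c : ℝ, AnalyticWithinAt ℝ (fun _ : ℝ => c) (Icc 0 1) 1 := fun c =>
    analyticWithinAt_const
  have hcos : AnalyticWithinAt ℝ (fun x => Real.cos (2 * f x)) (Icc 0 1) 1 :=
    Real.analyticAt_cos.comp_analyticWithinAt ((hc 2).mul hf)
  have hD := (hc 1).sub (hx.pow 2)
  refine ⟨fun x => 2 * (x - 1) / x,
    fun x => -((2 * (1 - x ^ 2) * Real.cos (2 * f x) - x ^ 2) / ((1 + x) ^ 2 * x ^ 2)),
    ((hc 2).mul (hx.sub (hc 1))).div hx one_ne_zero, ?_, ?_, fun x => ?_⟩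
  · exact ((((hc 2).mul hD).mul hcos).sub (hx.pow 2)).div ((((hc 1).add hx).pow 2).mul (hx.pow 2))
      (by norm_num) |>.neg
  · filter_upwards [self_mem_nhdsWithin] with x hx
    have h0 := hx.1.ne'
    have h1 : x - 1 ≠ 0 := (sub_neg.2 hx.2).ne
    have h2 : 1 + x ≠ 0 := by linarith [hx.1]
    refine ⟨by rw [deriv_leadCoeff_div h0]; field_simp, ?_⟩
    have h3 : (1 - x ^ 2) ^ 2 = (x - 1) ^ 2 * (1 + x) ^ 2 := by ring
    rw [leadCoeff, potential, h3]
    field_simp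
  · norm_num
    ring

end WaveMap

theorem mainTheorem4 (n : ℕ) (f : ℝ → ℝ) (hf : WaveMap.IsProfile n f) :
    WaveMap.HasFrobeniusIndices f 0 (-2) 1 ∧
      WaveMap.HasFrobeniusIndices f 1 (1 / 2) (1 / 2) ∧
      WaveMap.IsLimitPoint f 0 ∧
      WaveMap.IsLimitPoint f 1 ∧
      IsSelfAdjoint (WaveMap.maximalOperator f) :=
  ⟨WaveMap.hasFrobeniusIndices_zero (hf.analytic 0 (by simp)) hf.at_zero,
    WaveMap.hasFrobeniusIndices_one (hf.analytic 1 (by simp)), hf.isLimitPoint_zero,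
    WaveMap.isLimitPoint_one hf.continuousOn, hf.isSelfAdjoint_maximalOperator⟩
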